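/- Let $F$ be a free group on $x_1,x_2$, let $M=F/F''$, and let $\widehat M$ be the profinite completion of $M$ (the free profinite metabelian group of rank $2$). Let $\widehat M'$ be its closed derived subgroup and $\widehat A=\widehat M/\widehat M'$ its abelianization, with $a_i$ the image of $x_i$ in $\widehat A$; $\widehat A$ is a free $\widehat{\mathbb Z}$-module on $a_1,a_2$. Let $\widehat{\mathbb Z}[[\widehat A]]=\varprojlim\,(\mathbb Z/n)[\widehat A/U]$ ($n\ge 1$, $U\le\widehat A$ open) be the completed group algebra. Conjugation makes $\widehat M'$ a $\widehat{\mathbb Z}[[\widehat A]]$-module, written $m\mapsto m^r$; it is free of rank $1$ with basis $c=[x_1,x_2]=x_1x_2x_1^{-1}x_2^{-1}$. All homomorphisms and automorphisms of profinite groups are continuous, and $\operatorname{Out}=\operatorname{Aut}/\operatorname{Inn}$. For $\gamma\in\operatorname{Aut}(\widehat M)$ let $\det_c(\gamma)\in\widehat{\mathbb Z}[[\widehat A]]^\times$ be the element with $\gamma(c)=c^{\det_c(\gamma)}$; its class $\overline{\det}(\gamma)\in\widehat{\mathbb Z}[[\widehat A]]^\times/\widehat A$ depends only on the class of $\gamma$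 in $\operatorname{Out}(\widehat M)$. Put $$\operatorname{Out}^b(\widehat M)=\{\gamma\in\operatorname{Out}(\widehat M):\ \overline{\det}(\gamma)=\det(\gamma^{\mathrm{ab}})\ \text{in}\ \widehat{\mathbb Z}[[\widehat A]]^\times/\widehat A\},$$ where $\gamma^{\mathrm{ab}}\in\operatorname{GL}(\widehat A)$ is the automorphism induced by $\gamma$. Then $\operatorname{Out}^b(\widehat M)$ is a subgroup of $\operatorname{Out}(\widehat M)$, and $\gamma\mapsto\gamma^{\mathrm{ab}}$, written in the basis $a_1,a_2$, is a group isomorphism $\operatorname{Out}^b(\widehat M)\cong\operatorname{GL}_2(\widehat{\mathbb Z})$. Let $G$ be a finite metabelian group that can be generated by two elements, and let $\operatorname{Epi}^{\mathrm{ext}}(\widehat M,G)$ be the (nonempty) set of continuous surjective homomorphisms $\widehat M\to G$ modulo conjugation in $G$, with the left action of $\operatorname{Out}(G)$ by composition on the target and the right action of $\operatorname{Out}^b(\widehat M)$ by composition on the source. Then the action of $\operatorname{Out}(G)$ permutes the $\operatorname{Out}^b(\widehat M)$-orbits on $\operatorname{Epi}^{\mathrm{ext}}(\widehat M,G)$,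 and it permutes them transitively. Hence any two of these orbits are isomorphic as sets with $\operatorname{Out}^b(\widehat M)$-action. -/

import Mathlib

open Matrix
open scoped commutatorElement

noncomputable section

/-! ### Continuous automorphisms and outer automorphisms -/

section Aut

variable (G : Type*) [Group G] [TopologicalSpace G]

/-- The group of continuous (bicontinuous) automorphisms of a topological group, under composition:
`(f * g) x = f (g x)`. For a discrete group this is the full automorphism group. -/
instance instGroupContAut : Group (G ≃ₜ* G) where
  mul f g := g.trans f
  one := ContinuousMulEquiv.refl G
  inv f := f.symm
  mul_assoc _ _ _ := rfl
  one_mul _ := rfl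
  mul_one _ := rfl
  inv_mul_cancel f := ContinuousMulEquiv.ext fun x => f.symm_apply_apply x

variable [IsTopologicalGroup G]

/-- The homomorphism sending `g` to the inner automorphism `x ↦ g * x * g⁻¹`. -/
def innerAut : G →* (G ≃ₜ* G) where
  toFun g :=
    { MulAut.conj g with
      continuous_toFun := by
        change Continuous fun x => g * x * g⁻¹
        fun_prop
      continuous_invFun := by
        change Continuous fun x => g⁻¹ * x * g
        fun_prop }
  map_one' := ContinuousMulEquiv.ext fun x => by
    change 1 * x * 1⁻¹ = x
    simp
  map_mul' g h := ContinuousMulEquiv.ext fun x => by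
    change g * h * x * (g * h)⁻¹ = g * (h * x * h⁻¹) * g⁻¹
    group

instance innerAut_range_normal : (innerAut G).range.Normal where
  conj_mem := by
    rintro _ ⟨g, rfl⟩ f
    refine ⟨f g, ContinuousMulEquiv.ext fun x => ?_⟩
    change f g * x * (f g)⁻¹ = f (g * f.symm x * g⁻¹)
    simp

/-- The outer automorphism group: continuous automorphisms modulo inner automorphisms. -/
abbrev Out : Type _ := (G ≃ₜ* G) ⧸ (innerAut G).range

/-- The automorphism of the topological abelianization `G / closure [G, G]` induced by a continuous
automorphism of `G`. -/
def abAut : (G ≃ₜ* G) →* (TopologicalAbelianization G ≃ₜ* TopologicalAbelianization G) :=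
  have key : ∀ f : G ≃ₜ* G, (commutator G).topologicalClosure ≤
      (commutator G).topologicalClosure.comap (f : G →* G) := by
    intro f
    refine Subgroup.topologicalClosure_minimal _ ?_ ?_
    · intro x hx
      refine Subgroup.le_topologicalClosure _ ?_
      have : (commutator G).map (f : G →* G) ≤ commutator G := by
        rw [commutator_def, Subgroup.map_commutator]
        exact Subgroup.commutator_mono le_top le_top
      exact this ⟨x, hx, rfl⟩
    · exact (Subgroup.isClosed_topologicalClosure _).preimage f.continuous
  { toFun := fun f =>
      { toFun := QuotientGroup.map _ _ (f : G →* G) (key f)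
        invFun := QuotientGroup.map _ _ (f.symm : G →* G) (key f.symm)
        left_inv := by
          rintro ⟨x⟩
          exact congrArg QuotientGroup.mk (f.symm_apply_apply x)
        right_inv := by
          rintro ⟨x⟩
          exact congrArg QuotientGroup.mk (f.apply_symm_apply x)
        map_mul' := map_mul _
        continuous_toFun := QuotientGroup.continuous_mk.comp f.continuous |>.quotient_lift _
        continuous_invFun := QuotientGroup.continuous_mk.comp f.symm.continuous |>.quotient_lift _ }
    map_one' := by
      ext x
      induction x using QuotientGroup.induction_on
      rfl
    map_mul' := fun f g => by
      ext x
      induction x using QuotientGroup.induction_on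
      rfl }

/-- The homomorphism `Out(G) → Aut(G^ab)` induced by abelianization. -/
def outAb : Out G →* (TopologicalAbelianization G ≃ₜ* TopologicalAbelianization G) :=
  QuotientGroup.lift _ (abAut G) <| by
    rintro _ ⟨g, rfl⟩
    ext x
    induction x using QuotientGroup.induction_on with
    | H x =>
      change ((g * x * g⁻¹ : G) : TopologicalAbelianization G) = (x : TopologicalAbelianization G)
      rw [QuotientGroup.mk_mul, QuotientGroup.mk_mul, QuotientGroup.mk_inv,
        mul_comm (g : TopologicalAbelianization G), mul_inv_cancel_right]

end Aut

/-! ### Exterior epimorphisms -/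

section Epi

variable (A B : Type*) [Group A] [TopologicalSpace A] [Group B] [TopologicalSpace B]

/-- Continuous surjective homomorphisms `A → B`. -/
def Epi : Type _ := {f : A →ₜ* B // Function.Surjective f}

/-- Two epimorphisms are identified when they differ by conjugation in the target. -/
instance epiSetoid : Setoid (Epi A B) where
  r f g := ∃ b : B, ∀ a : A, g.1 a = b * f.1 a * b⁻¹
  iseqv :=
    { refl := fun f => ⟨1, fun a => by simp⟩
      symm := by
        rintro f g ⟨b, hb⟩
        exact ⟨b⁻¹, fun a => by rw [hb a]; group⟩
      trans := by
        rintro f g h ⟨b, hb⟩ ⟨c, hc⟩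
        exact ⟨c * b, fun a => by rw [hc a, hb a]; group⟩ }

/-- `Epi^ext(A, B)`: continuous surjective homomorphisms `A → B` modulo conjugation in `B`. -/
def EpiExt : Type _ := Quotient (epiSetoid A B)

variable {A B}

/-- Postcomposition `φ ↦ σ ∘ φ`. -/
def Epi.postcomp (σ : B ≃ₜ* B) (φ : Epi A B) : Epi A B :=
  ⟨(σ : B →ₜ* B).comp φ.1, σ.surjective.comp φ.2⟩

/-- Precomposition `φ ↦ φ ∘ γ`. -/
def Epi.precomp (γ : A ≃ₜ* A) (φ : Epi A B) : Epi A B :=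
  ⟨φ.1.comp (γ : A →ₜ* A), φ.2.comp γ.surjective⟩

/-- The left action of `Out(B)` on `Epi^ext(A, B)`: `[σ] • [φ] = [σ ∘ φ]`. -/
instance instOutTarget [IsTopologicalGroup B] : MulAction (Out B) (EpiExt A B) where
  smul := Quotient.map₂ Epi.postcomp <| by
    intro σ τ h φ ψ hφ
    obtain ⟨c, hc⟩ := QuotientGroup.leftRel_apply.mp h
    obtain ⟨b, hb⟩ := hφ
    have hτ : ∀ x, τ x = σ (c * x * c⁻¹) := by
      intro x
      have h2 : τ = σ * innerAut B c := by rw [hc, mul_inv_cancel_left]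
      rw [h2]
      rfl
    refine ⟨σ (c * b), fun a => ?_⟩
    change τ (ψ.1 a) = σ (c * b) * σ (φ.1 a) * (σ (c * b))⁻¹
    rw [hτ, hb]
    simp only [map_mul, map_inv]
    group
  one_smul := by
    rintro ⟨φ⟩
    rfl
  mul_smul := by
    rintro ⟨σ⟩ ⟨τ⟩ ⟨φ⟩
    rfl

/-- The right action of `Out(A)` on `Epi^ext(A, B)`: `[φ] · [γ] = [φ ∘ γ]`, written as a left action
of the opposite group. -/
instance instOutSource [IsTopologicalGroup A] : MulAction (Out A)ᵐᵒᵖ (EpiExt A B) where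
  smul γ := Quotient.map₂ Epi.precomp (by
    intro σ τ h φ ψ hφ
    obtain ⟨c, hc⟩ := QuotientGroup.leftRel_apply.mp h
    obtain ⟨b, hb⟩ := hφ
    have hτ : ∀ x, τ x = σ (c * x * c⁻¹) := by
      intro x
      have h2 : τ = σ * innerAut A c := by rw [hc, mul_inv_cancel_left]
      rw [h2]
      rfl
    refine ⟨b * φ.1 (σ c), fun a => ?_⟩
    change ψ.1 (τ a) = b * φ.1 (σ c) * φ.1 (σ a) * (b * φ.1 (σ c))⁻¹
    rw [hb, hτ]
    simp only [map_mul, map_inv]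
    group) γ.unop
  one_smul := by
    rintro ⟨φ⟩
    rfl
  mul_smul := by
    rintro ⟨⟨σ⟩⟩ ⟨⟨τ⟩⟩ ⟨φ⟩
    rfl

end Epi

/-! ### The profinite integers -/

/-- Compatible families in `∏ ℤ/n`. -/
def zhatSubring : Subring (∀ n : ℕ+, ZMod n) where
  carrier := {f | ∀ (n m : ℕ+) (h : (n : ℕ) ∣ m), ZMod.castHom h (ZMod n) (f m) = f n}
  mul_mem' ha hb n m h := by rw [Pi.mul_apply, map_mul, ha n m h, hb n m h, Pi.mul_apply]
  one_mem' n m h := by rw [Pi.one_apply, map_one, Pi.one_apply]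
  add_mem' ha hb n m h := by rw [Pi.add_apply, map_add, ha n m h, hb n m h, Pi.add_apply]
  zero_mem' n m h := by rw [Pi.zero_apply, map_zero, Pi.zero_apply]
  neg_mem' ha n m h := by rw [Pi.neg_apply, map_neg, ha n m h, Pi.neg_apply]

/-- The ring of profinite integers, the inverse limit of the rings `ℤ/n`. -/
def ZHat : Type := zhatSubring

instance : CommRing ZHat := inferInstanceAs (CommRing zhatSubring)

/-- The inverse limit topology, each `ℤ/n` being discrete. -/
instance : TopologicalSpace ZHat :=
  ⨅ n : ℕ+, TopologicalSpace.induced (fun z : zhatSubring => z.1 n) ⊥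

/-! ### Completed group algebras -/

section CompletedGroupAlgebra

variable (Q : Type*) [CommGroup Q] [TopologicalSpace Q]

/-- The transition map `(ℤ/m)[Q/V] → (ℤ/n)[Q/U]` for `n ∣ m` and `V ≤ U`. -/
def groupAlgebraTransition {n m : ℕ+} (h : (n : ℕ) ∣ m) {U V : OpenSubgroup Q} (hVU : V ≤ U) :
    MonoidAlgebra (ZMod m) (Q ⧸ V.toSubgroup) →+* MonoidAlgebra (ZMod n) (Q ⧸ U.toSubgroup) :=
  (MonoidAlgebra.mapDomainRingHom (ZMod n)
    (QuotientGroup.map V.toSubgroup U.toSubgroup (MonoidHom.id Q) hVU)).comp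
    (MonoidAlgebra.mapRingHom (Q ⧸ V.toSubgroup) (ZMod.castHom h (ZMod n)))

/-- Compatible families in `∏ (ℤ/n)[Q/U]`. -/
def completedGroupAlgebraSubring :
    Subring (∀ i : ℕ+ × OpenSubgroup Q, MonoidAlgebra (ZMod i.1) (Q ⧸ i.2.toSubgroup)) where
  carrier := {f | ∀ (n m : ℕ+) (h : (n : ℕ) ∣ m) (U V : OpenSubgroup Q) (hVU : V ≤ U),
    groupAlgebraTransition Q h hVU (f (m, V)) = f (n, U)}
  mul_mem' ha hb n m h U V hVU := by
    rw [Pi.mul_apply, map_mul, ha n m h U V hVU, hb n m h U V hVU, Pi.mul_apply]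
  one_mem' n m h U V hVU := by rw [Pi.one_apply, map_one, Pi.one_apply]
  add_mem' ha hb n m h U V hVU := by
    rw [Pi.add_apply, map_add, ha n m h U V hVU, hb n m h U V hVU, Pi.add_apply]
  zero_mem' n m h U V hVU := by rw [Pi.zero_apply, map_zero, Pi.zero_apply]
  neg_mem' ha n m h U V hVU := by rw [Pi.neg_apply, map_neg, ha n m h U V hVU, Pi.neg_apply]

/-- The completed group algebra `Ẑ⟦Q⟧ = lim (ℤ/n)[Q/U]` of a profinite abelian group `Q`, the limit
being over all `n ≥ 1` and all open subgroups `U` of `Q`. -/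
def CompletedGroupAlgebra : Type _ := completedGroupAlgebraSubring Q

instance : CommRing (CompletedGroupAlgebra Q) :=
  inferInstanceAs (CommRing (completedGroupAlgebraSubring Q))

/-- The inverse limit topology, each `(ℤ/n)[Q/U]` being discrete. -/
instance : TopologicalSpace (CompletedGroupAlgebra Q) :=
  ⨅ i : ℕ+ × OpenSubgroup Q,
    TopologicalSpace.induced (fun z : completedGroupAlgebraSubring Q => z.1 i) ⊥

/-- The structure homomorphism `Ẑ → Ẑ⟦Q⟧`. -/
def scalarHom : ZHat →+* CompletedGroupAlgebra Q :=
  RingHom.codRestrict (R := ZHat)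
    (RingHom.pi fun i : ℕ+ × OpenSubgroup Q =>
      (MonoidAlgebra.singleOneRingHom
        (R := ZMod i.1) (M := Q ⧸ i.2.toSubgroup)).comp
        ((Pi.evalRingHom (fun n : ℕ+ => ZMod n) i.1).comp zhatSubring.subtype))
    (completedGroupAlgebraSubring Q) <| by
    intro z n m h U V hVU
    have hz : ZMod.castHom h (ZMod n) (z.1 m) = z.1 n := z.2 n m h
    change groupAlgebraTransition Q h hVU (MonoidAlgebra.single 1 (z.1 m)) =
      MonoidAlgebra.single 1 (z.1 n)
    rw [← hz]
    simp [groupAlgebraTransition]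

/-- The canonical homomorphism `Q → Ẑ⟦Q⟧ˣ` onto the group-like elements. -/
def groupLike : Q →* (CompletedGroupAlgebra Q)ˣ :=
  MonoidHom.toHomUnits
    { toFun := fun q => (⟨fun i => MonoidAlgebra.single (q : Q ⧸ i.2.toSubgroup) 1, by
        intro n m h U V hVU
        have h1 : ZMod.castHom h (ZMod n) 1 = 1 := map_one _
        change groupAlgebraTransition Q h hVU
          (MonoidAlgebra.single (q : Q ⧸ V.toSubgroup) (1 : ZMod m)) =
            MonoidAlgebra.single (q : Q ⧸ U.toSubgroup) (1 : ZMod n)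
        rw [groupAlgebraTransition, RingHom.comp_apply, MonoidAlgebra.mapRingHom_single, h1]
        exact MonoidAlgebra.mapDomain_single⟩ : completedGroupAlgebraSubring Q)
      map_one' := Subtype.ext rfl
      map_mul' := fun p q => Subtype.ext <| funext fun i => by
        change MonoidAlgebra.single ((p * q : Q) : Q ⧸ i.2.toSubgroup) (1 : ZMod i.1) =
          MonoidAlgebra.single (p : Q ⧸ i.2.toSubgroup) 1 *
            MonoidAlgebra.single (q : Q ⧸ i.2.toSubgroup) 1
        simp }

end CompletedGroupAlgebra

/-! ### The free profinite metabelian group of rank 2 -/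

/-- The free metabelian group `M = F / F''` of rank 2, where `F` is free of rank 2. -/
abbrev FreeMetab : Type := FreeGroup (Fin 2) ⧸ derivedSeries (FreeGroup (Fin 2)) 2

/-- The free profinite metabelian group of rank 2: the profinite completion of `M`. -/
abbrev MHat : Type := ProfiniteGrp.ProfiniteCompletion.completion (GrpCat.of FreeMetab)

/-- Its abelianization. -/
abbrev AHat : Type := TopologicalAbelianization MHat

/-- The images in the profinite completion of the free generators `x₁, x₂`. -/
def gen (i : Fin 2) : MHat :=
  ProfiniteGrp.ProfiniteCompletion.etaFn (GrpCat.of FreeMetab)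
    (QuotientGroup.mk (FreeGroup.of i) : FreeMetab)

/-- The commutator `[x₁, x₂] = x₁ x₂ x₁⁻¹ x₂⁻¹`, a basis of the derived subgroup of `M` over `ℤ[A]`
and of the derived subgroup of its completion over `Ẑ⟦Â⟧`. -/
def basicCommutator : MHat := ⁅gen 0, gen 1⁆

/-- `m ^ r = y` for the action of `r ∈ Ẑ⟦Â⟧` on an element `m` of the closed derived subgroup. The
orbit map `r ↦ m ^ r` is the unique continuous homomorphism from the additive group of `Ẑ⟦Â⟧` that
sends the class of `g` to the conjugate `g m g⁻¹`. -/
def IsExp (m : MHat) (r : CompletedGroupAlgebra AHat) (y : MHat) : Prop :=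
  ∃ ω : Multiplicative (CompletedGroupAlgebra AHat) →ₜ* MHat,
    (∀ g : MHat, ω (Multiplicative.ofAdd (groupLike AHat (QuotientGroup.mk g)).val) = g * m * g⁻¹) ∧
    ω (Multiplicative.ofAdd r) = y

/-- `α` is the generalized Bachmuth determinant of the automorphism `γ` relative to `c`:
`γ(c) = c ^ α`. -/
def HasBachmuthDet (c : MHat) (γ : MHat ≃ₜ* MHat) (α : (CompletedGroupAlgebra AHat)ˣ) : Prop :=
  IsExp c α.val (γ c)

/-- The automorphism `σ` of `Â` is given by the matrix `A ∈ GL₂(Ẑ)` in the coordinates `e`. -/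
def HasMatrix (e : (Fin 2 → ZHat) ≃ₜ+ Additive AHat) (σ : AHat ≃ₜ* AHat)
    (A : GL (Fin 2) ZHat) : Prop :=
  ∀ v : Fin 2 → ZHat, Additive.ofMul (σ (e v).toMul) = e (A.val *ᵥ v)

/-- `u` is the determinant of the automorphism `σ` of the free `Ẑ`-module `Â` of rank 2, computed in
some basis. -/
def HasDet (σ : AHat ≃ₜ* AHat) (u : ZHatˣ) : Prop :=
  ∃ (e : (Fin 2 → ZHat) ≃ₜ+ Additive AHat) (A : GL (Fin 2) ZHat),
    HasMatrix e σ A ∧ Matrix.GeneralLinearGroup.det A = u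

/-- An outer automorphism `γ` is braid-like if its reduced determinant agrees with the determinant of
`γ^ab`, as elements of `Ẑ⟦Â⟧ˣ / Â`. -/
def IsBraidLike (γ : Out MHat) : Prop :=
  ∃ (g : MHat ≃ₜ* MHat) (α : (CompletedGroupAlgebra AHat)ˣ) (u : ZHatˣ),
    (g : Out MHat) = γ ∧ HasBachmuthDet basicCommutator g α ∧ HasDet (outAb MHat γ) u ∧
      (α : (CompletedGroupAlgebra AHat)ˣ ⧸ (groupLike AHat).range) =
        (Units.map (scalarHom AHat : ZHat →* CompletedGroupAlgebra AHat) u :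
          (CompletedGroupAlgebra AHat)ˣ)

end

/-!
Write `Λ = Ẑ⟦Â⟧`, `c = [x₁, x₂]`, and `c ^ r` (`expC r`) for the action of `r ∈ Λ` on `c`.

The closed derived subgroup of `MHat` is a free `Λ`-module on `c`. It is generated by `c` because
the generators commute modulo the powers of `c` (`mem_derivedMHat_iff`); it is free because the
affine representations over the rings `(ℤ/n)[Â/U]` turn `c ^ r` into the translation by `r (a₁ -
1)`, and `a₁ - 1` is a nonzero divisor in `Λ` (`expC_injective`). More precisely the Koszul
complex of `(a₁ - 1, a₂ - 1)` over `Λ` is exact (`CompletedGroupAlgebra.koszul_exact`); this is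
checked on the finite levels, where an element killed by `q - 1` is constant on the cosets of
`⟨q⟩` and hence becomes divisible by any prescribed integer after projection to a smaller
quotient.

*Injectivity on braid-like classes.* An endomorphism that is trivial on `Â` has the form `x₁ ↦ c ^
r x₁`, `x₂ ↦ c ^ s x₂`, and it sends `c` to `c ^ (1 + (1 - a₂) r + (a₁ - 1) s)`. If this is a
conjugate of `c`, then after conjugation `(r, s)` is a Koszul cycle, hence a boundary, which says
that the endomorphism is inner (`exists_eq_conj`).

*Surjectivity.* For an arbitrary lift of a matrix `A` to an endomorphism of `MHat`, the
determinant is congruent to `det A` modulo the augmentation ideal, as the Heisenberg groups over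
`ℤ/n` show (`level_top_eq_det`). Multiplying the images of the generators by powers of `c` changes
the determinant by an arbitrary element of the augmentation ideal, so a lift with determinant
exactly `det A` exists (`exists_endo_of_matrix`). The lifts of `A` and `A⁻¹` compose to inner
automorphisms, so they are automorphisms. The same uniqueness shows that the braid-like classes
form a group.

*Orbits.* The key point is that an endomorphism that is trivial on `Â` preserves every closed
normal subgroup `N` (`map_mem_of_isClosed`): with `r`, `s` as above, it multiplies `n ∈ N` by
`[x₁, n] ^ s [x₂, n] ^ (-r)`, and the `Λ`-submodule `N ∩ MHat'` contains both commutators. Given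
two epimorphisms `φ`, `ψ` onto `G`, Gaschütz' lemma produces an endomorphism `f` of `MHat` with `ψ
f = φ` whose matrix is invertible. Let `β` be the braid-like automorphism with the same matrix.
Then `f β⁻¹` is trivial on `Â`, so it preserves the kernel of `ψ` and descends to an automorphism
`σ` of `G` with `φ = σ ψ β` (`exists_eq_comp_comp`).
-/

noncomputable section

open ProfiniteGrp.ProfiniteCompletion (denseRange)

/-! ### The universal property of the free profinite metabelian group -/

/-- The projection of `MHat` to a finite quotient of the free metabelian group. -/
def projMHat (K : FiniteIndexNormalSubgroup FreeMetab) : MHat →* FreeMetab ⧸ K.toSubgroup where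
  toFun m := m.1 K
  map_one' := rfl
  map_mul' _ _ := rfl

theorem isOpen_preimage_projMHat (K : FiniteIndexNormalSubgroup FreeMetab)
    (s : Set (FreeMetab ⧸ K.toSubgroup)) : IsOpen (projMHat K ⁻¹' s) := by
  have h : Continuous fun m : MHat => m.1 K :=
    (continuous_apply K).comp continuous_subtype_val
  exact @IsOpen.preimage _ _ _ (_) _ h s ⟨⟩

theorem MHat.ext_proj {a b : MHat} (h : ∀ K, projMHat K a = projMHat K b) : a = b :=
  Subtype.ext (funext h)

/-- The free generators of the free metabelian group. -/
def metabGen (i : Fin 2) : FreeMetab := QuotientGroup.mk (FreeGroup.of i)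

theorem closure_metabGen : Subgroup.closure (Set.range metabGen) = ⊤ := by
  have h := congrArg (Subgroup.map (QuotientGroup.mk' (derivedSeries (FreeGroup (Fin 2)) 2)))
    (FreeGroup.closure_range_of (Fin 2))
  rw [MonoidHom.map_closure, ← MonoidHom.range_eq_map,
    MonoidHom.range_eq_top.2 (QuotientGroup.mk'_surjective _), ← Set.range_comp] at h
  exact h

theorem derivedSeries_freeMetab : derivedSeries FreeMetab 2 = ⊥ := by
  rw [← map_derivedSeries_eq (QuotientGroup.mk'_surjective (derivedSeries (FreeGroup (Fin 2)) 2)) 2]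
  exact QuotientGroup.map_mk'_self _

theorem closure_gen_dense :
    (Subgroup.closure (Set.range gen)).topologicalClosure = (⊤ : Subgroup MHat) := by
  have h1 : Subgroup.closure (Set.range gen) =
      (ProfiniteGrp.ProfiniteCompletion.eta (GrpCat.of FreeMetab)).hom.range := by
    rw [MonoidHom.range_eq_map]
    refine Eq.trans ?_ (congrArg _ closure_metabGen)
    refine Eq.trans ?_ (MonoidHom.map_closure _ _).symm
    rw [← Set.range_comp]
    rfl
  rw [h1, ← SetLike.coe_set_eq]
  exact (denseRange (GrpCat.of FreeMetab)).closure_range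

/-- A closed subgroup containing the generators is everything. -/
theorem MHat.eq_top_of_isClosed {H : Subgroup MHat} (hc : IsClosed (H : Set MHat))
    (hg : ∀ i, gen i ∈ H) : H = ⊤ := by
  rw [eq_top_iff, ← closure_gen_dense]
  refine Subgroup.topologicalClosure_minimal _ ?_ hc
  rw [Subgroup.closure_le]
  rintro _ ⟨i, rfl⟩
  exact hg i

theorem MHat.hom_ext {X : Type*} [Group X] [TopologicalSpace X] [T2Space X]
    {f g : MHat →ₜ* X} (h : ∀ i, f (gen i) = g (gen i)) : f = g := by
  have : MonoidHom.eqLocus (f : MHat →* X) (g : MHat →* X) = ⊤ :=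
    MHat.eq_top_of_isClosed (isClosed_eq f.continuous g.continuous) h
  ext x
  have hx : x ∈ MonoidHom.eqLocus (f : MHat →* X) (g : MHat →* X) := this ▸ Subgroup.mem_top x
  exact hx

theorem derivedSeries_two_eq_bot_of_comm {G : Type*} [Group G]
    (h : ∀ a ∈ commutator G, ∀ b ∈ commutator G, a * b = b * a) : derivedSeries G 2 = ⊥ := by
  rw [derivedSeries_succ, derivedSeries_one, Subgroup.commutator_eq_bot_iff_le_centralizer]
  intro a ha
  rw [Subgroup.mem_centralizer_iff]
  exact fun b hb => h b hb a ha

theorem comm_of_derivedSeries_two {G : Type*} [Group G] (h : derivedSeries G 2 = ⊥)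
    {a b : G} (ha : a ∈ commutator G) (hb : b ∈ commutator G) : a * b = b * a := by
  rw [derivedSeries_succ, derivedSeries_one, Subgroup.commutator_eq_bot_iff_le_centralizer] at h
  exact (Subgroup.mem_centralizer_iff.1 (h hb)) a ha

/-- A homomorphism from a free group to a metabelian group factors through the free metabelian
group. -/
theorem FreeMetab.exists_lift {G : Type*} [Group G] (hG : derivedSeries G 2 = ⊥) (f : Fin 2 → G) :
    ∃ φ : FreeMetab →* G, ∀ i, φ (metabGen i) = f i := by
  refine ⟨QuotientGroup.lift _ (FreeGroup.lift f) ?_, fun i => ?_⟩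
  · intro x hx
    have := map_derivedSeries_le_derivedSeries (FreeGroup.lift f) 2 ⟨x, hx, rfl⟩
    rwa [hG, Subgroup.mem_bot] at this
  · exact FreeGroup.lift_apply_of

theorem MHat.exists_lift {G : Type*} [Group G] [Finite G] [TopologicalSpace G]
    (hG : derivedSeries G 2 = ⊥) (f : Fin 2 → G) :
    ∃ φ : MHat →ₜ* G, ∀ i, φ (gen i) = f i := by
  obtain ⟨φ, hφ⟩ := FreeMetab.exists_lift hG f
  let K : FiniteIndexNormalSubgroup FreeMetab := FiniteIndexNormalSubgroup.ofSubgroup φ.ker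
  let ψ : FreeMetab ⧸ K.toSubgroup →* G := QuotientGroup.lift _ φ fun x hx => hx
  refine ⟨⟨ψ.comp (projMHat K), ?_⟩, hφ⟩
  exact continuous_def.2 fun s _ => isOpen_preimage_projMHat K (ψ ⁻¹' s)

theorem derivedSeries_quotient (K : Subgroup FreeMetab) [K.Normal] :
    derivedSeries (FreeMetab ⧸ K) 2 = ⊥ := by
  rw [← map_derivedSeries_eq (QuotientGroup.mk'_surjective K) 2, derivedSeries_freeMetab,
    Subgroup.map_bot]

theorem derivedSeries_mHat : derivedSeries MHat 2 = ⊥ := by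
  rw [eq_bot_iff]
  intro x hx
  refine MHat.ext_proj fun K => ?_
  have := map_derivedSeries_le_derivedSeries (projMHat K) 2 ⟨x, hx, rfl⟩
  rw [derivedSeries_quotient] at this
  exact this

theorem MHat.exists_endo (y : Fin 2 → MHat) : ∃ φ : MHat →ₜ* MHat, ∀ i, φ (gen i) = y i := by
  obtain ⟨φ, hφ⟩ := FreeMetab.exists_lift derivedSeries_mHat y
  have h := ProfiniteGrp.ProfiniteCompletion.lift_eta (G := GrpCat.of FreeMetab)
    (P := ProfiniteGrp.ProfiniteCompletion.completion (GrpCat.of FreeMetab)) (GrpCat.ofHom φ)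
  refine ⟨(ProfiniteGrp.ProfiniteCompletion.lift (G := GrpCat.of FreeMetab)
    (P := ProfiniteGrp.ProfiniteCompletion.completion (GrpCat.of FreeMetab)) (GrpCat.ofHom φ)).hom,
    fun i => ?_⟩
  rw [← hφ]
  exact CategoryTheory.ConcreteCategory.congr_hom h (metabGen i)

/-! ### The closed derived subgroup and the abelianization -/

/-- The closed derived subgroup of `MHat`. -/
abbrev derivedMHat : Subgroup MHat := (commutator MHat).topologicalClosure

theorem isClosed_derivedMHat : IsClosed (derivedMHat : Set MHat) :=
  Subgroup.isClosed_topologicalClosure _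

theorem commutator_mem_derivedMHat (a b : MHat) : ⁅a, b⁆ ∈ derivedMHat :=
  Subgroup.le_topologicalClosure _
    (Subgroup.commutator_mem_commutator (Subgroup.mem_top a) (Subgroup.mem_top b))

theorem derivedMHat_comm {a b : MHat} (ha : a ∈ derivedMHat) (hb : b ∈ derivedMHat) :
    a * b = b * a := by
  have h := (Subgroup.commGroupTopologicalClosure (commutator MHat) fun x y =>
    Subtype.ext (comm_of_derivedSeries_two derivedSeries_mHat x.2 y.2)).mul_comm ⟨a, ha⟩ ⟨b, hb⟩
  exact congrArg Subtype.val h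

instance : T2Space AHat := by
  have : IsClosed (derivedMHat : Set MHat) := isClosed_derivedMHat
  infer_instance

/-- The class of an element of `MHat` in the abelianization. -/
def toAHat : MHat →ₜ* AHat := ⟨QuotientGroup.mk' _, QuotientGroup.continuous_mk⟩

theorem toAHat_surjective : Function.Surjective toAHat := QuotientGroup.mk'_surjective _

theorem toAHat_eq_one_iff {m : MHat} : toAHat m = 1 ↔ m ∈ derivedMHat :=
  QuotientGroup.eq_one_iff m

theorem toAHat_eq_iff {m n : MHat} : toAHat m = toAHat n ↔ m⁻¹ * n ∈ derivedMHat :=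
  QuotientGroup.eq

/-- A continuous homomorphism from `MHat` to an abelian Hausdorff group factors through the
abelianization. -/
theorem AHat.exists_desc {X : Type*} [CommGroup X] [TopologicalSpace X] [T2Space X]
    (f : MHat →ₜ* X) : ∃ g : AHat →ₜ* X, ∀ m, g (toAHat m) = f m := by
  have h : derivedMHat ≤ (f : MHat →* X).ker := by
    refine Subgroup.topologicalClosure_minimal _ (Abelianization.commutator_subset_ker _) ?_
    exact isClosed_singleton.preimage f.continuous
  exact ⟨⟨QuotientGroup.lift _ (f : MHat →* X) h, f.continuous.quotient_lift _⟩, fun _ => rfl⟩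

/-! ### Inverse limits of discrete spaces -/

section InverseLimit

variable {ι X : Type*} {Y : ι → Type*} [t : TopologicalSpace X] {p : ∀ i, X → Y i}

theorem continuous_of_eq_iInf_induced (ht : t = ⨅ i, TopologicalSpace.induced (p i) ⊥)
    {Z : Type*} [TopologicalSpace Z] {f : Z → X}
    (h : ∀ i (y : Y i), IsOpen {z | p i (f z) = y}) : Continuous f := by
  subst ht
  refine continuous_iInf_rng.2 fun i => continuous_induced_rng.2 ?_
  let _ : TopologicalSpace (Y i) := ⊥
  have : DiscreteTopology (Y i) := ⟨rfl⟩
  exact continuous_discrete_rng.2 fun y => h i y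

theorem isOpen_fiber_of_eq_iInf_induced (ht : t = ⨅ i, TopologicalSpace.induced (p i) ⊥)
    (i : ι) (s : Set (Y i)) : IsOpen (p i ⁻¹' s) := by
  subst ht
  refine iInf_le (fun i => TopologicalSpace.induced (p i) ⊥) i _ ?_
  exact ⟨s, trivial, rfl⟩

theorem t2Space_of_eq_iInf_induced (ht : t = ⨅ i, TopologicalSpace.induced (p i) ⊥)
    (hinj : ∀ x y, (∀ i, p i x = p i y) → x = y) : T2Space X := by
  refine ⟨fun x y hxy => ?_⟩
  obtain ⟨i, hi⟩ : ∃ i, p i x ≠ p i y := by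
    by_contra! h
    exact hxy (hinj x y h)
  refine ⟨p i ⁻¹' {p i x}, p i ⁻¹' {p i y}, isOpen_fiber_of_eq_iInf_induced ht i _,
    isOpen_fiber_of_eq_iInf_induced ht i _, rfl, rfl, ?_⟩
  exact Disjoint.preimage _ (Set.disjoint_singleton.2 hi)

/-- In a directed inverse limit of discrete spaces, closure can be tested on each level. -/
theorem mem_closure_of_eq_iInf_induced (ht : t = ⨅ i, TopologicalSpace.induced (p i) ⊥)
    [Nonempty ι]
    (hdir : ∀ i j, ∃ l, ∀ x y, p l x = p l y → p i x = p i y ∧ p j x = p j y)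
    {K : Set X} {x : X} (h : ∀ i, ∃ k ∈ K, p i k = p i x) : x ∈ closure K := by
  have hb : (nhds x) = ⨅ i, Filter.principal (p i ⁻¹' {p i x}) := by
    subst ht
    rw [nhds_iInf]
    refine iInf_congr fun i => ?_
    let _ : TopologicalSpace (Y i) := ⊥
    have : DiscreteTopology (Y i) := ⟨rfl⟩
    rw [nhds_induced, nhds_discrete, Filter.comap_pure]
  rw [mem_closure_iff_nhds, hb]
  intro s hs
  rw [Filter.mem_iInf_of_directed] at hs
  · obtain ⟨i, hi⟩ := hs
    obtain ⟨k, hk, hkx⟩ := h i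
    exact ⟨k, Filter.mem_principal.1 hi hkx, hk⟩
  · intro i j
    obtain ⟨l, hl⟩ := hdir i j
    refine ⟨l, ?_, ?_⟩
    · exact Filter.principal_mono.2 fun y hy => (hl y x hy).1
    · exact Filter.principal_mono.2 fun y hy => (hl y x hy).2

theorem compactSpace_of_eq_iInf_induced (ht : t = ⨅ i, TopologicalSpace.induced (p i) ⊥)
    [∀ i, Finite (Y i)]
    (hinj : ∀ x y, (∀ i, p i x = p i y) → x = y)
    (hcl : ∀ f : ∀ i, Y i, (∀ i j, ∃ x, p i x = f i ∧ p j x = f j) → ∃ x, ∀ i, p i x = f i) :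
    CompactSpace X := by
  let _ : ∀ i, TopologicalSpace (Y i) := fun _ => ⊥
  have : ∀ i, DiscreteTopology (Y i) := fun _ => ⟨rfl⟩
  have hind : Topology.IsInducing (fun x i => p i x) := by
    refine ⟨?_⟩
    rw [ht, Pi.topologicalSpace, induced_iInf]
    exact iInf_congr fun i => by rw [induced_compose]; rfl
  refine Topology.IsClosedEmbedding.compactSpace (f := fun x i => p i x)
    ⟨⟨hind, fun x y h => hinj x y (congrFun h)⟩, ?_⟩
  refine isClosed_of_closure_subset fun f hf => ?_
  obtain ⟨x, hx⟩ := hcl f fun i j => by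
    have ho : IsOpen {g : ∀ i, Y i | g i = f i ∧ g j = f j} :=
      ((isOpen_discrete {f i}).preimage (continuous_apply i)).inter
        ((isOpen_discrete {f j}).preimage (continuous_apply j))
    obtain ⟨_, hg, x, rfl⟩ := mem_closure_iff.1 hf _ ho ⟨rfl, rfl⟩
    exact ⟨x, hg⟩
  exact ⟨x, funext hx⟩

end InverseLimit

/-! ### The topological ring of profinite integers -/

namespace ZHat

/-- Reduction modulo `n`. -/
def mod (n : ℕ+) : ZHat →+* ZMod n :=
  (Pi.evalRingHom (fun n : ℕ+ => ZMod n) n).comp zhatSubring.subtype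

theorem topology_eq : (inferInstance : TopologicalSpace ZHat) =
    ⨅ n : ℕ+, TopologicalSpace.induced (mod n) ⊥ := rfl

theorem ext {x y : ZHat} (h : ∀ n, mod n x = mod n y) : x = y := Subtype.ext (funext h)

theorem castHom_mod {n m : ℕ+} (h : (n : ℕ) ∣ m) (z : ZHat) :
    ZMod.castHom h (ZMod n) (mod m z) = mod n z := z.2 n m h

instance : T2Space ZHat := t2Space_of_eq_iInf_induced topology_eq fun _ _ h => ext h

instance (n : ℕ+) : Finite (ZMod n) := by
  have : NeZero (n : ℕ) := ⟨n.ne_zero⟩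
  infer_instance

instance : CompactSpace ZHat := by
  refine compactSpace_of_eq_iInf_induced topology_eq (fun _ _ h => ext h) fun f hf => ?_
  refine ⟨(⟨f, fun n m h => ?_⟩ : zhatSubring), fun _ => rfl⟩
  obtain ⟨x, h1, h2⟩ := hf n m
  rw [← h1, ← h2]
  exact castHom_mod h x

theorem isOpen_mod_eq (n : ℕ+) (a : ZMod n) : IsOpen {z | mod n z = a} :=
  isOpen_fiber_of_eq_iInf_induced topology_eq n {a}

theorem continuous_of_mod {Z : Type*} [TopologicalSpace Z] {f : Z → ZHat}
    (h : ∀ (n : ℕ+) (a : ZMod n), IsOpen {z | mod n (f z) = a}) : Continuous f :=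
  continuous_of_eq_iInf_induced topology_eq h

instance : IsTopologicalRing ZHat where
  continuous_add := by
    refine continuous_of_mod fun n a => isOpen_iff_forall_mem_open.2 fun z hz => ?_
    refine ⟨{w | mod n w = mod n z.1} ×ˢ {w | mod n w = mod n z.2}, ?_,
      (isOpen_mod_eq _ _).prod (isOpen_mod_eq _ _), rfl, rfl⟩
    rintro w ⟨h1, h2⟩
    simp only [Set.mem_ofPred_eq, map_add] at hz h1 h2 ⊢
    rw [h1, h2, hz]
  continuous_mul := by
    refine continuous_of_mod fun n a => isOpen_iff_forall_mem_open.2 fun z hz => ?_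
    refine ⟨{w | mod n w = mod n z.1} ×ˢ {w | mod n w = mod n z.2}, ?_,
      (isOpen_mod_eq _ _).prod (isOpen_mod_eq _ _), rfl, rfl⟩
    rintro w ⟨h1, h2⟩
    simp only [Set.mem_ofPred_eq, map_mul] at hz h1 h2 ⊢
    rw [h1, h2, hz]
  continuous_neg := by
    refine continuous_of_mod fun n a => ?_
    convert isOpen_mod_eq n (-a) using 1
    ext z
    simp [map_neg, neg_eq_iff_eq_neg]

theorem mem_closure_of_mod {K : Set ZHat} {x : ZHat}
    (h : ∀ n, ∃ k ∈ K, mod n k = mod n x) : x ∈ closure K := by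
  refine mem_closure_of_eq_iInf_induced topology_eq (fun i j => ⟨i * j, fun x y hxy => ?_⟩) h
  have hi : (i : ℕ) ∣ (i * j : ℕ+) := by simp
  have hj : (j : ℕ) ∣ (i * j : ℕ+) := by simp
  exact ⟨by rw [← castHom_mod hi, hxy, castHom_mod], by rw [← castHom_mod hj, hxy, castHom_mod]⟩

theorem denseRange_intCast : DenseRange (Int.cast : ℤ → ZHat) := by
  intro x
  refine mem_closure_of_mod fun n => ?_
  obtain ⟨k, hk⟩ := ZMod.intCast_surjective (mod n x)
  exact ⟨k, ⟨k, rfl⟩, by rw [map_intCast, hk]⟩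

/-- A closed additive subgroup of `ZHat` containing `1` is everything. -/
theorem eq_top_of_isClosed {H : AddSubgroup ZHat} (hc : IsClosed (H : Set ZHat))
    (h1 : (1 : ZHat) ∈ H) (x : ZHat) : x ∈ H := by
  have h : closure (Set.range (Int.cast : ℤ → ZHat)) ⊆ H := by
    refine hc.closure_subset_iff.2 ?_
    rintro _ ⟨k, rfl⟩
    have := H.zsmul_mem h1 k
    rwa [zsmul_one] at this
  exact h (denseRange_intCast x)

end ZHat

/-! ### The topological ring structure of the completed group algebra -/

namespace CompletedGroupAlgebra

variable {Q : Type*} [CommGroup Q] [TopologicalSpace Q]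

/-- The projection of the completed group algebra to `(ℤ/n)[Q/U]`. -/
def level (i : ℕ+ × OpenSubgroup Q) :
    CompletedGroupAlgebra Q →+* MonoidAlgebra (ZMod i.1) (Q ⧸ i.2.toSubgroup) :=
  (Pi.evalRingHom (fun i : ℕ+ × OpenSubgroup Q =>
    MonoidAlgebra (ZMod i.1) (Q ⧸ i.2.toSubgroup)) i).comp (completedGroupAlgebraSubring Q).subtype

theorem topology_eq : (inferInstance : TopologicalSpace (CompletedGroupAlgebra Q)) =
    ⨅ i : ℕ+ × OpenSubgroup Q, TopologicalSpace.induced (level i) ⊥ := rfl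

theorem ext {x y : CompletedGroupAlgebra Q} (h : ∀ i, level i x = level i y) : x = y :=
  Subtype.ext (funext h)

theorem transition_level {n m : ℕ+} (h : (n : ℕ) ∣ m) {U V : OpenSubgroup Q} (hVU : V ≤ U)
    (z : CompletedGroupAlgebra Q) :
    groupAlgebraTransition Q h hVU (level (m, V) z) = level (n, U) z := z.2 n m h U V hVU

theorem level_groupLike (i : ℕ+ × OpenSubgroup Q) (q : Q) :
    level i (groupLike Q q).val = MonoidAlgebra.single (q : Q ⧸ i.2.toSubgroup) 1 := rfl

theorem level_scalarHom (i : ℕ+ × OpenSubgroup Q) (z : ZHat) :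
    level i (scalarHom Q z) = MonoidAlgebra.single 1 (ZHat.mod i.1 z) := rfl

instance : T2Space (CompletedGroupAlgebra Q) :=
  t2Space_of_eq_iInf_induced topology_eq fun _ _ h => ext h

theorem isOpen_level_eq (i : ℕ+ × OpenSubgroup Q) (s) :
    IsOpen (level i ⁻¹' s) :=
  isOpen_fiber_of_eq_iInf_induced topology_eq i s

theorem continuous_of_level {Z : Type*} [TopologicalSpace Z] {f : Z → CompletedGroupAlgebra Q}
    (h : ∀ i a, IsOpen {z | level i (f z) = a}) : Continuous f :=
  continuous_of_eq_iInf_induced topology_eq h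

instance : IsTopologicalRing (CompletedGroupAlgebra Q) where
  continuous_add := by
    refine continuous_of_level fun n a => isOpen_iff_forall_mem_open.2 fun z hz => ?_
    refine ⟨{w | level n w = level n z.1} ×ˢ {w | level n w = level n z.2}, ?_,
      (isOpen_level_eq _ {_}).prod (isOpen_level_eq _ {_}), rfl, rfl⟩
    rintro w ⟨h1, h2⟩
    simp only [Set.mem_ofPred_eq, map_add] at hz h1 h2 ⊢
    rw [h1, h2, hz]
  continuous_mul := by
    refine continuous_of_level fun n a => isOpen_iff_forall_mem_open.2 fun z hz => ?_
    refine ⟨{w | level n w = level n z.1} ×ˢ {w | level n w = level n z.2}, ?_,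
      (isOpen_level_eq _ {_}).prod (isOpen_level_eq _ {_}), rfl, rfl⟩
    rintro w ⟨h1, h2⟩
    simp only [Set.mem_ofPred_eq, map_mul] at hz h1 h2 ⊢
    rw [h1, h2, hz]
  continuous_neg := by
    refine continuous_of_level fun n a => ?_
    convert isOpen_level_eq n {-a} using 1
    ext z
    simp [map_neg, neg_eq_iff_eq_neg]

theorem continuous_scalarHom : Continuous (scalarHom Q) := by
  refine continuous_of_level fun i a => isOpen_iff_forall_mem_open.2 fun z hz => ?_
  refine ⟨{w | ZHat.mod i.1 w = ZHat.mod i.1 z}, ?_, ZHat.isOpen_mod_eq _ _, rfl⟩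
  intro w hw
  simp only [Set.mem_ofPred_eq, level_scalarHom] at hz hw ⊢
  rw [hw, hz]

theorem mem_closure_of_level {K : Set (CompletedGroupAlgebra Q)} {x : CompletedGroupAlgebra Q}
    (h : ∀ i, ∃ k ∈ K, level i k = level i x) : x ∈ closure K := by
  refine mem_closure_of_eq_iInf_induced topology_eq
    (fun i j => ⟨(i.1 * j.1, i.2 ⊓ j.2), fun x y hxy => ?_⟩) h
  have hi : (i.1 : ℕ) ∣ (i.1 * j.1 : ℕ+) := by simp
  have hj : (j.1 : ℕ) ∣ (i.1 * j.1 : ℕ+) := by simp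
  have hi' : i.2 ⊓ j.2 ≤ i.2 := inf_le_left
  have hj' : i.2 ⊓ j.2 ≤ j.2 := inf_le_right
  exact ⟨(transition_level hi hi' x).symm.trans (hxy ▸ transition_level hi hi' y),
    (transition_level hj hj' x).symm.trans (hxy ▸ transition_level hj hj' y)⟩

/-- Every element of a level is the image of an integral combination of group-like elements. -/
theorem exists_level_eq (i : ℕ+ × OpenSubgroup Q)
    (f : MonoidAlgebra (ZMod i.1) (Q ⧸ i.2.toSubgroup)) :
    ∃ x ∈ AddSubgroup.closure (Set.range fun q : Q => (groupLike Q q).val), level i x = f := by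
  induction f using MonoidAlgebra.induction_linear with
  | zero => exact ⟨0, zero_mem _, map_zero _⟩
  | add f g hf hg =>
    obtain ⟨x, hx, rfl⟩ := hf
    obtain ⟨y, hy, rfl⟩ := hg
    exact ⟨x + y, add_mem hx hy, map_add _ _ _⟩
  | single q a =>
    obtain ⟨q, rfl⟩ := QuotientGroup.mk_surjective q
    obtain ⟨k, rfl⟩ := ZMod.intCast_surjective a
    refine ⟨k • (groupLike Q q).val,
      zsmul_mem (AddSubgroup.subset_closure (Set.mem_range_self q)) k, ?_⟩
    rw [map_zsmul, level_groupLike, MonoidAlgebra.smul_single, zsmul_one]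

/-- A closed additive subgroup containing the group-like elements is everything. -/
theorem mem_of_isClosed {H : AddSubgroup (CompletedGroupAlgebra Q)}
    (hc : IsClosed (H : Set (CompletedGroupAlgebra Q)))
    (hg : ∀ q, (groupLike Q q).val ∈ H) (x : CompletedGroupAlgebra Q) : x ∈ H := by
  have h : x ∈ closure (H : Set (CompletedGroupAlgebra Q)) := by
    refine mem_closure_of_level fun i => ?_
    obtain ⟨y, hy, hyx⟩ := exists_level_eq i (level i x)
    have hle : AddSubgroup.closure (Set.range fun q : Q => (groupLike Q q).val) ≤ H :=
      (AddSubgroup.closure_le _).2 (Set.range_subset_iff.2 hg)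
    exact ⟨y, hle hy, hyx⟩
  rwa [hc.closure_eq] at h

/-- Continuous additive homomorphisms on the completed group algebra are determined by their values
on group-like elements. -/
theorem addHom_ext {X : Type*} [AddGroup X] [TopologicalSpace X] [T2Space X]
    {f g : CompletedGroupAlgebra Q →+ X} (hf : Continuous f) (hg : Continuous g)
    (h : ∀ q, f (groupLike Q q).val = g (groupLike Q q).val) (x : CompletedGroupAlgebra Q) :
    f x = g x :=
  mem_of_isClosed (H := f.eqLocus g) (isClosed_eq hf hg) h x

variable [IsTopologicalGroup Q] [CompactSpace Q]

instance finite_level (i : ℕ+ × OpenSubgroup Q) :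
    Finite (MonoidAlgebra (ZMod i.1) (Q ⧸ i.2.toSubgroup)) := by
  have : Finite (Q ⧸ i.2.toSubgroup) := Subgroup.quotient_finite_of_isOpen _ i.2.isOpen
  exact Finite.of_injective (fun f => (f.coeff : (Q ⧸ i.2.toSubgroup) → ZMod i.1)) fun f g h =>
    MonoidAlgebra.coeff_injective (DFunLike.coe_injective h)

instance : CompactSpace (CompletedGroupAlgebra Q) := by
  refine compactSpace_of_eq_iInf_induced topology_eq (fun _ _ h => ext h) fun f hf => ?_
  refine ⟨(⟨f, fun n m h U V hVU => ?_⟩ : completedGroupAlgebraSubring Q), fun _ => rfl⟩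
  obtain ⟨x, h1, h2⟩ := hf (n, U) (m, V)
  rw [← h1, ← h2]
  exact transition_level h hVU x

/-- Membership in an ideal generated by two elements can be tested on the levels, since such an
ideal is compact. -/
theorem exists_eq_mul_add_mul {a b x : CompletedGroupAlgebra Q}
    (h : ∀ i, ∃ r s, level i (r * a + s * b) = level i x) : ∃ r s, r * a + s * b = x := by
  let f : CompletedGroupAlgebra Q × CompletedGroupAlgebra Q → CompletedGroupAlgebra Q :=
    fun rs => rs.1 * a + rs.2 * b
  have hc : IsClosed (Set.range f) :=
    (isCompact_range ((continuous_fst.mul continuous_const).add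
      (continuous_snd.mul continuous_const) : Continuous f)).isClosed
  have hx : x ∈ closure (Set.range f) := mem_closure_of_level fun i => by
    obtain ⟨r, s, hrs⟩ := h i
    exact ⟨r * a + s * b, ⟨(r, s), rfl⟩, hrs⟩
  rw [hc.closure_eq] at hx
  obtain ⟨⟨r, s⟩, hrs⟩ := hx
  exact ⟨r, s, hrs⟩

end CompletedGroupAlgebra

/-! ### Translation-invariant elements and augmentation ideals of group rings -/

theorem sum_eq_zero_of_invariant {Q A : Type*} [Group Q] [Fintype Q] [AddCommMonoid A]
    (F : Q → A) (s : Subgroup Q) (hF : ∀ g, ∀ z ∈ s, F (g * z) = F g)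
    (hs : ∀ a : A, Nat.card s • a = 0) : ∑ g, F g = 0 := by
  classical
  have : Fintype (Q ⧸ s) := Fintype.ofFinite _
  have : Fintype s := Fintype.ofFinite _
  rw [← (Subgroup.groupEquivQuotientProdSubgroup (s := s)).symm.sum_comp, Fintype.sum_prod_type]
  refine Finset.sum_eq_zero fun c _ => ?_
  have h : ∀ z : s, F ((Subgroup.groupEquivQuotientProdSubgroup (s := s)).symm (c, z)) =
      F ((Subgroup.groupEquivQuotientProdSubgroup (s := s)).symm (c, 1)) := by
    intro z
    have hc : ∀ z : s, ∃ w ∈ s,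
        (Subgroup.groupEquivQuotientProdSubgroup (s := s)).symm (c, z) = c.out * w := by
      intro z
      refine ⟨c.out⁻¹ * (Subgroup.groupEquivQuotientProdSubgroup (s := s)).symm (c, z), ?_, by
        group⟩
      rw [← QuotientGroup.eq, QuotientGroup.out_eq']
      have := congrArg Prod.fst
        ((Subgroup.groupEquivQuotientProdSubgroup (s := s)).apply_symm_apply (c, z))
      exact this.symm
    obtain ⟨w, hw, h1⟩ := hc z
    obtain ⟨w', hw', h2⟩ := hc 1
    rw [h1, h2, hF _ _ hw, hF _ _ hw']
  rw [Finset.sum_congr rfl fun z _ => h z, Finset.sum_const, Finset.card_univ,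
    ← Nat.card_eq_fintype_card, hs]

theorem MonoidAlgebra.coeff_mapDomain_eq_sum {R Q P : Type*} [Semiring R] [Fintype Q]
    [DecidableEq P] (π : Q → P) (f : MonoidAlgebra R Q) (h : P) :
    (MonoidAlgebra.mapDomain π f).coeff h = ∑ g, if π g = h then f.coeff g else 0 := by
  rw [MonoidAlgebra.mapDomain, MonoidAlgebra.coeff_ofCoeff, Finsupp.mapDomain,
    Finsupp.sum_fintype _ _ (by simp), Finsupp.finsetSum_apply]
  simp [Finsupp.single_apply]

/-- An element of `R[Q]` invariant under `y` dies in `R[P]` if `y` maps to `1` and the order of `y`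
annihilates `R`. -/
theorem MonoidAlgebra.mapDomain_eq_zero_of_invariant {R Q P : Type*} [Ring R] [Group Q] [Group P]
    [Finite Q] (π : Q →* P) (f : MonoidAlgebra R Q) {y : Q} (hy : π y = 1)
    (hord : (orderOf y : R) = 0) (hf : ∀ g, f.coeff (g * y) = f.coeff g) :
    MonoidAlgebra.mapDomain π f = 0 := by
  classical
  have : Fintype Q := Fintype.ofFinite _
  ext h
  rw [MonoidAlgebra.coeff_mapDomain_eq_sum]
  refine sum_eq_zero_of_invariant _ (Subgroup.zpowers y) ?_ ?_
  · intro g z hz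
    obtain ⟨k, rfl⟩ := (mem_powers_iff_mem_zpowers (x := y)).2 hz
    dsimp only
    have h1 : f.coeff (g * y ^ k) = f.coeff g := by
      induction k with
      | zero => simp
      | succ k ih => rw [pow_succ, ← mul_assoc, hf, ih ⟨k, by simp⟩]
    rw [h1, map_mul, map_pow, hy, one_pow, mul_one]
  · intro a
    rw [Nat.card_zpowers, nsmul_eq_mul, hord, zero_mul]

theorem MonoidAlgebra.sub_mapDomain_mem {R Q : Type*} [CommRing R] [CommGroup Q]
    {I : Ideal (MonoidAlgebra R Q)} {φ : Q → Q}
    (h : ∀ g, MonoidAlgebra.single g 1 - MonoidAlgebra.single (φ g) 1 ∈ I)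
    (f : MonoidAlgebra R Q) : f - MonoidAlgebra.mapDomain φ f ∈ I := by
  induction f using MonoidAlgebra.induction_linear with
  | zero => simp
  | add f g hf hg =>
    rw [MonoidAlgebra.mapDomain_add, add_sub_add_comm]
    exact add_mem hf hg
  | single q a =>
    rw [MonoidAlgebra.mapDomain_single]
    have := I.mul_mem_left (MonoidAlgebra.single 1 a) (h q)
    rwa [mul_sub, MonoidAlgebra.single_mul_single, MonoidAlgebra.single_mul_single, one_mul,
      one_mul, mul_one] at this

/-- The kernel of `R[Q] → R[P]` is generated by `q - 1` if the kernel of `Q → P` is generated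
by `q`. -/
theorem MonoidAlgebra.dvd_of_mapDomain_eq_zero {R Q P : Type*} [CommRing R] [CommGroup Q] [Finite Q]
    [Group P] (π : Q →* P) {q : Q} (hq : π.ker ≤ Subgroup.zpowers q) {f : MonoidAlgebra R Q}
    (hf : MonoidAlgebra.mapDomain π f = 0) :
    MonoidAlgebra.single q 1 - 1 ∣ f := by
  rw [← Ideal.mem_span_singleton]
  let σ := Function.invFun π
  have h0 : MonoidAlgebra.mapDomain (σ ∘ π) f = 0 := by
    have h1 : MonoidAlgebra.mapDomain (σ ∘ π) f =
        MonoidAlgebra.mapDomain σ (MonoidAlgebra.mapDomain π f) := by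
      simp only [MonoidAlgebra.mapDomain, MonoidAlgebra.coeff_ofCoeff, Finsupp.mapDomain_comp]
    rw [h1, hf, MonoidAlgebra.mapDomain_zero]
  have h := MonoidAlgebra.sub_mapDomain_mem
    (I := Ideal.span {(MonoidAlgebra.single q 1 - 1 : MonoidAlgebra R Q)}) (φ := σ ∘ π) ?_ f
  · rwa [h0, sub_zero] at h
  intro g
  have hg : g⁻¹ * σ (π g) ∈ π.ker := by
    have hσ : π (σ (π g)) = π g := Function.invFun_eq ⟨g, rfl⟩
    rw [MonoidHom.mem_ker, map_mul, map_inv, hσ, inv_mul_cancel]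
  obtain ⟨k, hk⟩ := mem_powers_iff_mem_zpowers.2 (hq hg)
  have hk' : σ (π g) = g * q ^ k := by
    rw [show q ^ k = g⁻¹ * σ (π g) from hk, mul_inv_cancel_left]
  rw [Function.comp_apply, hk', Ideal.mem_span_singleton]
  have h1 : (MonoidAlgebra.single g 1 - MonoidAlgebra.single (g * q ^ k) 1 : MonoidAlgebra R Q) =
      -MonoidAlgebra.single g 1 * (MonoidAlgebra.single q 1 ^ k - 1 ^ k) := by
    rw [MonoidAlgebra.single_pow, one_pow, one_pow, neg_mul, mul_sub,
      MonoidAlgebra.single_mul_single, mul_one, mul_one]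
    ring
  rw [h1]
  exact (sub_dvd_pow_sub_pow _ _ k).mul_left _

/-! ### Koszul exactness in the completed group algebra -/

namespace CompletedGroupAlgebra

variable {Q : Type*} [CommGroup Q] [TopologicalSpace Q]

/-- The group-like element of the completed group algebra attached to a group element. -/
abbrev gl (q : Q) : CompletedGroupAlgebra Q := (groupLike Q q).val

theorem mapDomain_level {n : ℕ+} {U V : OpenSubgroup Q} (hVU : V ≤ U)
    (z : CompletedGroupAlgebra Q) :
    MonoidAlgebra.mapDomain (QuotientGroup.map V.toSubgroup U.toSubgroup (MonoidHom.id Q) hVU)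
      (level (n, V) z) = level (n, U) z := by
  rw [← transition_level (dvd_refl (n : ℕ)) hVU, groupAlgebraTransition, RingHom.comp_apply,
    ZMod.castHom_self, MonoidAlgebra.mapRingHom_id, RingHom.id_apply]
  rfl

theorem gl_mul (p q : Q) : gl (p * q) = gl p * gl q := by
  simp [gl]

theorem gl_one : gl (1 : Q) = 1 := by
  simp [gl]

variable [IsTopologicalGroup Q] [CompactSpace Q]

/-- `x - 1` is a nonzero divisor in `Ẑ⟦Q/P⟧` if `x` is the image of a generator under projections of
`Q/P` to all finite cyclic groups. The elements of `Ẑ⟦Q/P⟧` are represented by their lifts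
to `Ẑ⟦Q⟧`. -/
theorem level_eq_zero_of_mul_sub_one {x : Q} {P : Subgroup Q}
    (hχ : ∀ N : ℕ+, ∃ χ : Q →ₜ* Multiplicative (ZMod N), χ x = Multiplicative.ofAdd 1 ∧
      ∀ p ∈ P, χ p = 1) {r : CompletedGroupAlgebra Q}
    (hr : ∀ n, ∀ V : OpenSubgroup Q, P ≤ V.toSubgroup → level (n, V) (r * (gl x - 1)) = 0)
    (n : ℕ+) (U : OpenSubgroup Q) (hU : P ≤ U.toSubgroup) : level (n, U) r = 0 := by
  have : Finite (Q ⧸ U.toSubgroup) := Subgroup.quotient_finite_of_isOpen _ U.isOpen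
  let k : ℕ+ := ⟨Nat.card (Q ⧸ U.toSubgroup), Nat.card_pos⟩
  obtain ⟨χ, hχx, hχP⟩ := hχ (n * k)
  let W : OpenSubgroup Q := ⟨(χ : Q →* _).ker, by
    exact (isOpen_discrete {1}).preimage χ.continuous⟩
  have hVU : U ⊓ W ≤ U := inf_le_left
  have : Finite (Q ⧸ (U ⊓ W).toSubgroup) := Subgroup.quotient_finite_of_isOpen _ (U ⊓ W).isOpen
  rw [← mapDomain_level hVU]
  have hinv : ∀ g, (level (n, U ⊓ W) r).coeff (g * (x : Q ⧸ (U ⊓ W).toSubgroup)) =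
      (level (n, U ⊓ W) r).coeff g := by
    intro g
    have h := hr n (U ⊓ W) fun p hp => ⟨hU hp, hχP p hp⟩
    rw [map_mul, map_sub, map_one, level_groupLike, mul_sub, mul_one, sub_eq_zero] at h
    have h2 := congrArg (fun f => f.coeff (g * (x : Q ⧸ (U ⊓ W).toSubgroup))) h
    simpa using h2.symm
  have hxk : x ^ (k : ℕ) ∈ U.toSubgroup := by
    rw [← QuotientGroup.eq_one_iff, QuotientGroup.mk_pow]
    exact pow_card_eq_one'
  refine MonoidAlgebra.mapDomain_eq_zero_of_invariant _ _
    (y := ((x ^ (k : ℕ) : Q) : Q ⧸ (U ⊓ W).toSubgroup)) ?_ ?_ ?_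
  · exact (QuotientGroup.eq_one_iff _).2 hxk
  · rw [ZMod.natCast_eq_zero_iff]
    have h1 := pow_orderOf_eq_one ((x ^ (k : ℕ) : Q) : Q ⧸ (U ⊓ W).toSubgroup)
    rw [← QuotientGroup.mk_pow, QuotientGroup.eq_one_iff, ← pow_mul] at h1
    have h2 : χ (x ^ _) = 1 := h1.2
    rw [map_pow, hχx, ← ofAdd_nsmul, nsmul_one, ofAdd_eq_one, ZMod.natCast_eq_zero_iff,
      PNat.mul_coe, mul_comm] at h2
    exact Nat.dvd_of_mul_dvd_mul_left k.pos h2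
  · intro g
    rw [QuotientGroup.mk_pow]
    generalize (k : ℕ) = k
    induction k with
    | zero => simp
    | succ k ih => rw [pow_succ, ← mul_assoc, hinv, ih]

theorem eq_zero_of_mul_sub_one {x : Q}
    (hχ : ∀ N : ℕ+, ∃ χ : Q →ₜ* Multiplicative (ZMod N), χ x = Multiplicative.ofAdd 1)
    {r : CompletedGroupAlgebra Q} (hr : r * (gl x - 1) = 0) : r = 0 := by
  refine ext fun i => ?_
  rw [map_zero]
  refine level_eq_zero_of_mul_sub_one (x := x) (P := ⊥) (fun N => ?_) ?_ i.1 i.2 bot_le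
  · obtain ⟨χ, h⟩ := hχ N
    exact ⟨χ, h, by rintro p rfl; exact map_one χ⟩
  · intro n V _
    rw [hr, map_zero]

/-- An element of `Ẑ⟦Q⟧` that vanishes in `Ẑ⟦Q/⟨x⟩⟧` is a multiple of `x - 1`. -/
theorem dvd_of_level_eq_zero {x : Q} {s : CompletedGroupAlgebra Q}
    (hs : ∀ n, ∀ U : OpenSubgroup Q, x ∈ U → level (n, U) s = 0) : ∃ t, t * (gl x - 1) = s := by
  obtain ⟨t, u, h⟩ := exists_eq_mul_add_mul (a := gl x - 1) (b := 0) (x := s) fun i => by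
    obtain ⟨n, U⟩ := i
    have : Finite (Q ⧸ U.toSubgroup) := Subgroup.quotient_finite_of_isOpen _ U.isOpen
    let U' : OpenSubgroup Q := ⟨U.toSubgroup ⊔ Subgroup.zpowers x,
      Subgroup.isOpen_mono le_sup_left U.isOpen⟩
    have hU' : U ≤ U' := fun _ h => Subgroup.mem_sup_left h
    have h0 := hs n U' (Subgroup.mem_sup_right (Subgroup.mem_zpowers x))
    rw [← mapDomain_level hU'] at h0
    obtain ⟨t', ht'⟩ := MonoidAlgebra.dvd_of_mapDomain_eq_zero _
      (q := (x : Q ⧸ U.toSubgroup)) (by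
        intro g hg
        obtain ⟨g, rfl⟩ := QuotientGroup.mk_surjective g
        obtain ⟨u, hu, z, hz, rfl⟩ := Subgroup.mem_sup.1 ((QuotientGroup.eq_one_iff g).1 hg)
        obtain ⟨k, rfl⟩ := hz
        refine ⟨k, ?_⟩
        simp only [QuotientGroup.mk_mul, (QuotientGroup.eq_one_iff u).2 hu, one_mul]
        rfl) h0
    obtain ⟨t, -, rfl⟩ := exists_level_eq (n, U) t'
    refine ⟨t, 0, ?_⟩
    rw [ht', mul_zero, add_zero, map_mul, map_sub, map_one, level_groupLike, mul_comm]
  exact ⟨t, by rw [← h, mul_zero, add_zero]⟩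

/-- Exactness of the Koszul complex of `(a - 1, b - 1)` in the middle. -/
theorem koszul_exact {a b : Q}
    (ha : ∀ N : ℕ+, ∃ χ : Q →ₜ* Multiplicative (ZMod N), χ a = Multiplicative.ofAdd 1)
    (hb : ∀ N : ℕ+, ∃ χ : Q →ₜ* Multiplicative (ZMod N), χ b = Multiplicative.ofAdd 1 ∧ χ a = 1)
    {r s : CompletedGroupAlgebra Q} (h : r * (gl a - 1) + s * (gl b - 1) = 0) :
    ∃ t, s = t * (gl a - 1) ∧ r = -t * (gl b - 1) := by
  obtain ⟨t, ht⟩ := dvd_of_level_eq_zero (x := a) (s := s) fun n U hU => by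
    refine level_eq_zero_of_mul_sub_one (x := b) (P := Subgroup.zpowers a) (fun N => ?_) ?_ n U
      (by simpa using hU)
    · obtain ⟨χ, h1, h2⟩ := hb N
      refine ⟨χ, h1, ?_⟩
      rintro _ ⟨k, rfl⟩
      simp [h2]
    · intro n V hV
      have haV : ((a : Q) : Q ⧸ V.toSubgroup) = 1 :=
        (QuotientGroup.eq_one_iff a).2 (hV (Subgroup.mem_zpowers a))
      have := congrArg (level (n, V)) h
      rwa [map_add, map_mul _ r, map_sub, map_one, level_groupLike, haV,
        ← MonoidAlgebra.one_def, sub_self, mul_zero, zero_add, map_zero] at this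
  refine ⟨t, ht.symm, ?_⟩
  have h0 : (r + t * (gl b - 1)) * (gl a - 1) = 0 := by
    rw [← h, ← ht]
    ring
  rw [neg_mul]
  exact eq_neg_of_add_eq_zero_left (eq_zero_of_mul_sub_one ha h0)

/-- The augmentation ideal of `Ẑ⟦Q⟧` is generated by `b - 1` and `b' - 1` if `b` and `b'`
topologically generate `Q`. -/
theorem exists_eq_of_augmentation_eq_zero {b b' : Q}
    (hbb : ∀ H : Subgroup Q, IsClosed (H : Set Q) → b ∈ H → b' ∈ H → H = ⊤)
    {r : CompletedGroupAlgebra Q} (hr : ∀ n, level (n, ⊤) r = 0) :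
    ∃ u v, u * (gl b - 1) + v * (gl b' - 1) = r := by
  refine exists_eq_mul_add_mul fun i => ?_
  obtain ⟨n, U⟩ := i
  let I : Ideal (MonoidAlgebra (ZMod n) (Q ⧸ U.toSubgroup)) :=
    Ideal.span {MonoidAlgebra.single (b : Q ⧸ U.toSubgroup) 1 - 1,
      MonoidAlgebra.single (b' : Q ⧸ U.toSubgroup) 1 - 1}
  let H : Subgroup Q :=
    { carrier := {q | MonoidAlgebra.single (q : Q ⧸ U.toSubgroup) 1 - 1 ∈ I}
      one_mem' := by
        change MonoidAlgebra.single (1 : Q ⧸ U.toSubgroup) 1 - 1 ∈ I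
        rw [← MonoidAlgebra.one_def, sub_self]
        exact zero_mem I
      mul_mem' := by
        intro p q hp hq
        have := add_mem (I.mul_mem_left (MonoidAlgebra.single (p : Q ⧸ U.toSubgroup) 1) hq) hp
        rwa [mul_sub, MonoidAlgebra.single_mul_single, mul_one, mul_one, sub_add_sub_cancel] at this
      inv_mem' := by
        intro p hp
        have := neg_mem (I.mul_mem_left (MonoidAlgebra.single (p⁻¹ : Q ⧸ U.toSubgroup) 1) hp)
        rwa [mul_sub, MonoidAlgebra.single_mul_single, mul_one, mul_one, inv_mul_cancel,
          ← MonoidAlgebra.one_def, neg_sub] at this }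
  have hUH : U.toSubgroup ≤ H := by
    intro u hu
    change MonoidAlgebra.single (u : Q ⧸ U.toSubgroup) 1 - 1 ∈ I
    rw [(QuotientGroup.eq_one_iff u).2 hu, ← MonoidAlgebra.one_def, sub_self]
    exact zero_mem I
  have hH : H = ⊤ := hbb H
    (Subgroup.isClosed_of_isOpen H (Subgroup.isOpen_mono hUH U.isOpen))
    (Ideal.subset_span (Set.mem_insert _ _))
    (Ideal.subset_span (Set.mem_insert_of_mem _ rfl))
  have hI : level (n, U) r ∈ I := by
    have h1 := MonoidAlgebra.sub_mapDomain_mem (I := I) (φ := fun _ => 1) (fun g => by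
      obtain ⟨g, rfl⟩ := QuotientGroup.mk_surjective g
      have hg : g ∈ H := hH ▸ Subgroup.mem_top g
      exact hg) (level (n, U) r)
    have hU : U ≤ ⊤ := le_top
    have h2 : MonoidAlgebra.mapDomain (fun _ => (1 : Q ⧸ U.toSubgroup)) (level (n, U) r) =
        MonoidAlgebra.mapDomain (fun _ => (1 : Q ⧸ U.toSubgroup)) (level (n, ⊤) r) := by
      rw [← mapDomain_level hU]
      simp only [MonoidAlgebra.mapDomain, MonoidAlgebra.coeff_ofCoeff, ← Finsupp.mapDomain_comp]
      rfl
    rwa [h2, hr, MonoidAlgebra.mapDomain_zero, sub_zero] at h1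
  obtain ⟨u', v', huv⟩ := Ideal.mem_span_pair.1 hI
  obtain ⟨u, -, rfl⟩ := exists_level_eq (n, U) u'
  obtain ⟨v, -, rfl⟩ := exists_level_eq (n, U) v'
  refine ⟨u, v, ?_⟩
  rw [← huv, map_add, map_mul, map_mul, map_sub, map_sub, map_one, level_groupLike,
    level_groupLike]

end CompletedGroupAlgebra

open CompletedGroupAlgebra (gl level)

/-! ### Exponentiation of the basic commutator -/

/-- The images of the free generators in the abelianization. -/
abbrev genA (i : Fin 2) : AHat := toAHat (gen i)

theorem basicCommutator_mem : basicCommutator ∈ derivedMHat := commutator_mem_derivedMHat _ _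

/-- Conjugation on the derived subgroup factors through the abelianization. -/
theorem conj_eq_of_toAHat_eq {g h d : MHat} (hgh : toAHat g = toAHat h) (hd : d ∈ derivedMHat) :
    g * d * g⁻¹ = h * d * h⁻¹ := by
  have h1 := derivedMHat_comm (toAHat_eq_iff.1 hgh) hd
  have h2 : d = (g⁻¹ * h) * d * (g⁻¹ * h)⁻¹ := by rw [h1, mul_inv_cancel_right]
  nth_rw 1 [h2]
  group

/-- Exponentiation in a finite quotient: the sum over `AHat / U` of the conjugates of the basic
commutator, with multiplicities in `ℤ/n`, where `U` is the image of the kernel and `n` is the order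
of the quotient. -/
theorem exists_expLevel {G : Type*} [Group G] [Finite G] (hG : derivedSeries G 2 = ⊥)
    (φ : MHat →* G) (hφ : IsOpen (φ.ker : Set MHat)) :
    ∃ ω : CompletedGroupAlgebra AHat → G, (∀ x y, ω (x + y) = ω x * ω y) ∧
      (∀ s, IsOpen (ω ⁻¹' s)) ∧ ∀ g, ω (gl (toAHat g)) = φ (g * basicCommutator * g⁻¹) := by
  let U : OpenSubgroup AHat := ⟨φ.ker.map (toAHat : MHat →* AHat),
    (QuotientGroup.isOpenMap_coe (N := derivedMHat)) _ hφ⟩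
  let n : ℕ+ := ⟨Nat.card G, Nat.card_pos⟩
  let _ : CommGroup (commutator G) :=
    { (inferInstance : Group (commutator G)) with
      mul_comm := fun x y => Subtype.ext (comm_of_derivedSeries_two hG x.2 y.2) }
  have hmem : ∀ g, φ (g * basicCommutator * g⁻¹) ∈ commutator G := by
    intro g
    have h1 : φ basicCommutator ∈ commutator G := by
      rw [basicCommutator, map_commutatorElement]
      exact Subgroup.commutator_mem_commutator (Subgroup.mem_top _) (Subgroup.mem_top _)
    rw [map_mul, map_mul, map_inv]
    exact (inferInstance : (commutator G).Normal).conj_mem _ h1 _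
  let d : AHat ⧸ U.toSubgroup → Additive (commutator G) := fun q =>
    Additive.ofMul ⟨_, hmem (Function.surjInv toAHat_surjective q.out)⟩
  have hn : ∀ a : Additive (commutator G), (n : ℕ) • a = 0 := by
    intro a
    apply Additive.toMul.injective
    rw [toMul_nsmul, toMul_zero]
    exact Subtype.ext (pow_card_eq_one' (G := G) (x := a.toMul.1))
  let F : ((AHat ⧸ U.toSubgroup) →₀ ZMod n) →+ Additive (commutator G) :=
    Finsupp.liftAddHom fun q => ZMod.lift n ⟨zmultiplesHom _ (d q), by
      rw [zmultiplesHom_apply, natCast_zsmul, hn]⟩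
  refine ⟨fun x => (F (level (n, U) x).coeff).toMul.1, ?_, ?_, ?_⟩
  · intro x y
    dsimp only
    rw [map_add, MonoidAlgebra.coeff_add, map_add, toMul_add]
    rfl
  · intro s
    exact CompletedGroupAlgebra.isOpen_level_eq (n, U) {f | (F f.coeff).toMul.1 ∈ s}
  · intro g
    have h1 : F (level (n, U) (gl (toAHat g))).coeff = d (toAHat g : AHat ⧸ U.toSubgroup) := by
      rw [CompletedGroupAlgebra.level_groupLike, MonoidAlgebra.coeff_single]
      simp only [F, Finsupp.liftAddHom_apply_single]
      have := ZMod.lift_coe (n : ℕ) ⟨zmultiplesHom _ (d (toAHat g : AHat ⧸ U.toSubgroup)), by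
        rw [zmultiplesHom_apply, natCast_zsmul, hn]⟩ 1
      rw [Int.cast_one] at this
      exact this.trans (one_zsmul _)
    dsimp only
    rw [h1]
    change φ _ = φ _
    set h := Function.surjInv toAHat_surjective (toAHat g : AHat ⧸ U.toSubgroup).out with hh
    have h2 : ((toAHat h : AHat) : AHat ⧸ U.toSubgroup) = (toAHat g : AHat ⧸ U.toSubgroup) := by
      rw [hh, Function.surjInv_eq toAHat_surjective, QuotientGroup.out_eq']
    obtain ⟨k, hk, hk'⟩ := QuotientGroup.eq.1 h2
    have h3 : toAHat (h * k) = toAHat g := by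
      rw [map_mul]
      exact (congrArg (toAHat h * ·) hk').trans (mul_inv_cancel_left _ _)
    rw [← conj_eq_of_toAHat_eq h3 basicCommutator_mem]
    have hk1 : φ k = 1 := hk
    simp [hk1]

/-- Locally constant homomorphisms out of `Ẑ⟦Â⟧` agree if they agree on group-like elements. -/
theorem addHom_eq_of_isOpen {G : Type*} [Group G] {f₁ f₂ : CompletedGroupAlgebra AHat → G}
    (h₁ : ∀ x y, f₁ (x + y) = f₁ x * f₁ y) (h₂ : ∀ x y, f₂ (x + y) = f₂ x * f₂ y)
    (o₁ : ∀ s, IsOpen (f₁ ⁻¹' s)) (o₂ : ∀ s, IsOpen (f₂ ⁻¹' s))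
    (h : ∀ g, f₁ (gl (toAHat g)) = f₂ (gl (toAHat g))) : f₁ = f₂ := by
  let _ : TopologicalSpace G := ⊥
  have : DiscreteTopology G := ⟨rfl⟩
  have h₁' : ∀ x y, Additive.ofMul (f₁ (x + y)) = Additive.ofMul (f₁ x) + Additive.ofMul (f₁ y) :=
    fun x y => congrArg _ (h₁ x y)
  have h₂' : ∀ x y, Additive.ofMul (f₂ (x + y)) = Additive.ofMul (f₂ x) + Additive.ofMul (f₂ y) :=
    fun x y => congrArg _ (h₂ x y)
  funext x
  refine Additive.ofMul.injective (CompletedGroupAlgebra.addHom_ext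
    (f := AddMonoidHom.mk' (fun x => Additive.ofMul (f₁ x)) h₁')
    (g := AddMonoidHom.mk' (fun x => Additive.ofMul (f₂ x)) h₂')
    (continuous_def.2 fun s _ => o₁ s) (continuous_def.2 fun s _ => o₂ s) ?_ x)
  intro q
  obtain ⟨g, rfl⟩ := toAHat_surjective q
  exact h g

/-- The exponentiations in the finite quotients are compatible, since they are determined by their
values on group-like elements; their limit is exponentiation in `MHat`. -/
theorem exists_expHom : ∃ ω : Multiplicative (CompletedGroupAlgebra AHat) →ₜ* MHat,
    ∀ g : MHat, ω (Multiplicative.ofAdd (gl (toAHat g))) = g * basicCommutator * g⁻¹ := by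
  choose ω hadd hopen hgl using fun K : FiniteIndexNormalSubgroup FreeMetab =>
    exists_expLevel (derivedSeries_quotient K.toSubgroup) (projMHat K)
      (isOpen_preimage_projMHat K {1})
  have hcompat : ∀ {K K' : FiniteIndexNormalSubgroup FreeMetab} (h : K ≤ K'),
      (fun x => QuotientGroup.map K.toSubgroup K'.toSubgroup (MonoidHom.id _) h (ω K x)) =
        ω K' := by
    intro K K' h
    refine addHom_eq_of_isOpen (fun x y => ?_) (hadd K') (fun s => ?_) (hopen K') fun g => ?_
    · rw [hadd, map_mul]
    · exact hopen K (QuotientGroup.map K.toSubgroup K'.toSubgroup (MonoidHom.id _) h ⁻¹' s)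
    · rw [hgl, hgl]
      exact (g * basicCommutator * g⁻¹).2 (CategoryTheory.homOfLE h)
  let f : Multiplicative (CompletedGroupAlgebra AHat) → MHat := fun x =>
    ⟨fun K => ω K x.toAdd, fun K K' h => congrFun (hcompat h.le) x.toAdd⟩
  refine ⟨⟨MonoidHom.mk' f fun x y => Subtype.ext (funext fun K => hadd K _ _), ?_⟩, fun g => ?_⟩
  · refine Continuous.subtype_mk (continuous_pi fun K => ?_) _
    exact continuous_def.2 fun s _ => hopen K s
  · exact MHat.ext_proj fun K => hgl K g

/-- The map `r ↦ c ^ r` for the basic commutator `c`, as an additive homomorphism. -/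
def expAdd : CompletedGroupAlgebra AHat →+ Additive MHat :=
  MonoidHom.toAdditiveRight
    (exists_expHom.choose : Multiplicative (CompletedGroupAlgebra AHat) →* MHat)

/-- The power `c ^ r` of the basic commutator `c`. -/
def expC (r : CompletedGroupAlgebra AHat) : MHat := (expAdd r).toMul

theorem continuous_expC : Continuous expC := exists_expHom.choose.continuous

theorem expC_gl (g : MHat) : expC (gl (toAHat g)) = g * basicCommutator * g⁻¹ :=
  exists_expHom.choose_spec g

theorem expC_zero : expC 0 = 1 := by rw [expC, map_zero, toMul_zero]

theorem expC_add (r s : CompletedGroupAlgebra AHat) : expC (r + s) = expC r * expC s := by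
  rw [expC, map_add, toMul_add]
  rfl

theorem expC_neg (r : CompletedGroupAlgebra AHat) : expC (-r) = (expC r)⁻¹ := by
  rw [expC, map_neg, toMul_neg]
  rfl

theorem expC_one : expC 1 = basicCommutator := by
  have := expC_gl 1
  rwa [map_one, CompletedGroupAlgebra.gl_one, one_mul, inv_one, mul_one] at this

/-- Two continuous homomorphisms out of `Ẑ⟦Â⟧` agree if they agree on group-like elements. -/
theorem eq_of_eq_gl {X : Type*} [Group X] [TopologicalSpace X] [T2Space X]
    {f₁ f₂ : CompletedGroupAlgebra AHat → X}
    (h₁ : ∀ x y, f₁ (x + y) = f₁ x * f₁ y) (h₂ : ∀ x y, f₂ (x + y) = f₂ x * f₂ y)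
    (c₁ : Continuous f₁) (c₂ : Continuous f₂)
    (h : ∀ g, f₁ (gl (toAHat g)) = f₂ (gl (toAHat g))) (x) : f₁ x = f₂ x := by
  have : T2Space (Additive X) := ‹T2Space X›
  refine Additive.ofMul.injective (CompletedGroupAlgebra.addHom_ext
    (f := AddMonoidHom.mk' (fun x => Additive.ofMul (f₁ x)) fun x y => congrArg _ (h₁ x y))
    (g := AddMonoidHom.mk' (fun x => Additive.ofMul (f₂ x)) fun x y => congrArg _ (h₂ x y))
    c₁ c₂ ?_ x)
  intro q
  obtain ⟨g, rfl⟩ := toAHat_surjective q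
  exact h g

theorem conj_expC (g : MHat) (r : CompletedGroupAlgebra AHat) :
    g * expC r * g⁻¹ = expC (gl (toAHat g) * r) := by
  refine eq_of_eq_gl (f₁ := fun r => g * expC r * g⁻¹) (f₂ := fun r => expC (gl (toAHat g) * r))
    (fun x y => ?_) (fun x y => ?_) ?_ ?_ (fun h => ?_) r
  · simp only [expC_add]
    group
  · simp only [mul_add, expC_add]
  · exact (continuous_const.mul continuous_expC).mul continuous_const
  · exact continuous_expC.comp (continuous_const.mul continuous_id)
  · rw [← CompletedGroupAlgebra.gl_mul, ← map_mul, expC_gl, expC_gl]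
    group

/-- The powers of the basic commutator form the closed derived subgroup: modulo the (closed, normal)
subgroup of powers, the generators commute. -/
theorem mem_derivedMHat_iff {m : MHat} : m ∈ derivedMHat ↔ ∃ r, expC r = m := by
  let E : Subgroup MHat :=
    { carrier := Set.range expC
      one_mem' := ⟨0, expC_zero⟩
      mul_mem' := by
        rintro _ _ ⟨r, rfl⟩ ⟨s, rfl⟩
        exact ⟨r + s, expC_add r s⟩
      inv_mem' := by
        rintro _ ⟨r, rfl⟩
        exact ⟨-r, expC_neg r⟩ }
  have hE : IsClosed (E : Set MHat) := (isCompact_range continuous_expC).isClosed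
  have hnorm : E.Normal := ⟨by
    rintro _ ⟨r, rfl⟩ g
    exact ⟨_, (conj_expC g r).symm⟩⟩
  have hED : E ≤ derivedMHat := by
    rintro _ ⟨r, rfl⟩
    have h : ∀ r, expC r ∈ derivedMHat := by
      intro r
      refine CompletedGroupAlgebra.mem_of_isClosed
        (H := AddSubgroup.comap expAdd derivedMHat.toAddSubgroup) ?_ ?_ r
      · exact isClosed_derivedMHat.preimage continuous_expC
      · intro q
        obtain ⟨g, rfl⟩ := toAHat_surjective q
        change expC _ ∈ derivedMHat
        rw [expC_gl]
        exact (inferInstance : derivedMHat.Normal).conj_mem _ basicCommutator_mem g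
    exact h r
  have hcent : ∀ {x : MHat}, (∀ i, ⁅x, gen i⁆ ∈ E) → ∀ y, ⁅x, y⁆ ∈ E := by
    intro x hx y
    let C : Subgroup MHat := (Subgroup.centralizer {(x : MHat ⧸ E)}).comap (QuotientGroup.mk' E)
    have hC : ∀ z, z ∈ C ↔ ⁅x, z⁆ ∈ E := by
      intro z
      have h : ((⁅x, z⁆ : MHat) : MHat ⧸ E) = ⁅(x : MHat ⧸ E), (z : MHat ⧸ E)⁆ :=
        map_commutatorElement (QuotientGroup.mk' E) x z
      rw [Subgroup.mem_comap, Subgroup.mem_centralizer_singleton_iff, ← QuotientGroup.eq_one_iff,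
        h, commutatorElement_eq_one_iff_mul_comm]
      exact eq_comm
    have hcl : IsClosed (C : Set MHat) := by
      have : (C : Set MHat) = (fun z => ⁅x, z⁆) ⁻¹' E := Set.ext hC
      rw [this]
      refine hE.preimage ?_
      simp only [commutatorElement_def]
      fun_prop
    have := MHat.eq_top_of_isClosed hcl fun i => (hC _).2 (hx i)
    exact (hC y).1 (this ▸ Subgroup.mem_top y)
  have hc : basicCommutator ∈ E := ⟨1, expC_one⟩
  have h00 : ∀ i j, ⁅gen i, gen j⁆ ∈ E := by
    intro i j
    fin_cases i <;> fin_cases j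
    · simp [commutatorElement_self, E.one_mem]
    · exact hc
    · have := E.inv_mem hc
      rwa [basicCommutator, commutatorElement_inv] at this
    · simp [commutatorElement_self, E.one_mem]
  have hall : ∀ x y : MHat, ⁅x, y⁆ ∈ E := by
    intro x y
    refine hcent (fun i => ?_) y
    rw [← inv_mem_iff, commutatorElement_inv]
    exact hcent (h00 i) x
  have hDE : derivedMHat ≤ E := by
    refine Subgroup.topologicalClosure_minimal _ ?_ hE
    rw [commutator_def, Subgroup.commutator_le]
    exact fun x _ y _ => hall x y
  exact ⟨fun h => hDE h, fun h => hED h⟩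

theorem expC_mem (r : CompletedGroupAlgebra AHat) : expC r ∈ derivedMHat :=
  mem_derivedMHat_iff.2 ⟨r, rfl⟩

/-! ### Freeness of the derived module -/

/-- The group of affine transformations `x ↦ u * x + v` of a commutative ring. -/
@[ext]
structure AffineGroup (S : Type*) [CommRing S] where
  /-- The translation part. -/
  v : S
  /-- The linear part. -/
  u : Sˣ

namespace AffineGroup

variable {S : Type*} [CommRing S]

instance : Mul (AffineGroup S) := ⟨fun x y => ⟨x.v + x.u * y.v, x.u * y.u⟩⟩
instance : One (AffineGroup S) := ⟨⟨0, 1⟩⟩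
instance : Inv (AffineGroup S) := ⟨fun x => ⟨-(x.u⁻¹ * x.v : S), x.u⁻¹⟩⟩

@[simp] theorem mul_v (x y : AffineGroup S) : (x * y).v = x.v + x.u * y.v := rfl
@[simp] theorem mul_u (x y : AffineGroup S) : (x * y).u = x.u * y.u := rfl
@[simp] theorem one_v : (1 : AffineGroup S).v = 0 := rfl
@[simp] theorem one_u : (1 : AffineGroup S).u = 1 := rfl
@[simp] theorem inv_v (x : AffineGroup S) : x⁻¹.v = -(x.u⁻¹ * x.v : S) := rfl
@[simp] theorem inv_u (x : AffineGroup S) : x⁻¹.u = x.u⁻¹ := rfl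

instance : Group (AffineGroup S) where
  mul_assoc x y z := by ext <;> simp [mul_add, mul_assoc, add_assoc]
  one_mul x := by ext <;> simp
  mul_one x := by ext <;> simp
  inv_mul_cancel x := by ext <;> simp

/-- The linear part as a homomorphism. -/
def linear : AffineGroup S →* Sˣ where
  toFun := u
  map_one' := rfl
  map_mul' _ _ := rfl

instance [Finite S] : Finite (AffineGroup S) :=
  Finite.of_injective (fun x : AffineGroup S => (x.v, x.u)) fun _ _ h =>
    AffineGroup.ext (congrArg Prod.fst h) (congrArg Prod.snd h)

theorem derivedSeries_two : derivedSeries (AffineGroup S) 2 = ⊥ := by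
  refine derivedSeries_two_eq_bot_of_comm fun a ha b hb => ?_
  have h : ∀ x ∈ commutator (AffineGroup S), x.u = 1 := fun x hx =>
    MonoidHom.mem_ker.1 (Abelianization.commutator_subset_ker (linear (S := S)) hx)
  ext
  · simp [h a ha, h b hb, add_comm]
  · simp [mul_comm]

theorem commutator_eq (a b : Sˣ) :
    ⁅(⟨0, a⟩ : AffineGroup S), (⟨1, b⟩ : AffineGroup S)⁆ = (⟨(a : S) - 1, 1⟩ : AffineGroup S) := by
  rw [commutatorElement_def]
  ext
  · simp [mul_comm (a : S), sub_eq_add_neg]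
  · simp [mul_comm a]

theorem conj_translation (x : AffineGroup S) (w : S) : x * ⟨w, 1⟩ * x⁻¹ = ⟨x.u * w, 1⟩ := by
  ext
  · simp
  · simp

end AffineGroup

theorem derivedSeries_two_of_comm (G : Type*) [CommGroup G] : derivedSeries G 2 = ⊥ :=
  derivedSeries_two_eq_bot_of_comm fun a _ b _ => mul_comm a b

/-- The abelianization has characters of order `N` with prescribed values on the generators. -/
theorem AHat.exists_character (N : ℕ+) (f : Fin 2 → ZMod N) :
    ∃ χ : AHat →ₜ* Multiplicative (ZMod N), ∀ i, χ (genA i) = Multiplicative.ofAdd (f i) := by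
  have : Finite (Multiplicative (ZMod N)) := (inferInstance : Finite (ZMod N))
  obtain ⟨φ, hφ⟩ := MHat.exists_lift (derivedSeries_two_of_comm (Multiplicative (ZMod N)))
    fun i => Multiplicative.ofAdd (f i)
  obtain ⟨χ, hχ⟩ := AHat.exists_desc φ
  exact ⟨χ, fun i => (hχ _).trans (hφ i)⟩

theorem continuous_comp_level {Z : Type*} [TopologicalSpace Z] (i) (f : _ → Z) :
    Continuous fun r : CompletedGroupAlgebra AHat => f (level i r) :=
  continuous_def.2 fun s _ => CompletedGroupAlgebra.isOpen_level_eq i (f ⁻¹' s)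

/-- The basic commutator generates a free module. Its power `c ^ r` acts on each `(ℤ/n)[Â/U]`, via
the affine representation with `x₁ ↦ (x ↦ a₁ x)` and `x₂ ↦ (x ↦ a₂ x + 1)`, as the translation
by `r (a₁ - 1)`. -/
theorem expC_injective : Function.Injective expC := by
  suffices h : ∀ r, expC r = 1 → r = 0 by
    intro r s hrs
    refine sub_eq_zero.1 (h _ ?_)
    rw [sub_eq_add_neg, expC_add, expC_neg, hrs, mul_inv_cancel]
  intro r hr
  refine CompletedGroupAlgebra.eq_zero_of_mul_sub_one (x := genA 0) (fun N => ?_)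
    (CompletedGroupAlgebra.ext fun i => ?_)
  · obtain ⟨χ, hχ⟩ := AHat.exists_character N fun _ => 1
    exact ⟨χ, hχ 0⟩
  let S := MonoidAlgebra (ZMod i.1) (AHat ⧸ i.2.toSubgroup)
  have : Finite S := CompletedGroupAlgebra.finite_level i
  let _ : TopologicalSpace (AffineGroup S) := ⊥
  have : DiscreteTopology (AffineGroup S) := ⟨rfl⟩
  let ρ : AHat →* Sˣ :=
    (Units.map (level i : CompletedGroupAlgebra AHat →* S)).comp (groupLike AHat)
  obtain ⟨φ, hφ⟩ := MHat.exists_lift (AffineGroup.derivedSeries_two (S := S))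
    ![⟨0, ρ (genA 0)⟩, ⟨1, ρ (genA 1)⟩]
  have hφ0 : φ (gen 0) = ⟨0, ρ (genA 0)⟩ := hφ 0
  have hφ1 : φ (gen 1) = ⟨1, ρ (genA 1)⟩ := hφ 1
  have hu : ∀ g, (φ g).u = ρ (toAHat g) := by
    intro g
    let H : Subgroup MHat := MonoidHom.eqLocus (AffineGroup.linear.comp (φ : MHat →* AffineGroup S))
      (ρ.comp (toAHat : MHat →* AHat))
    have hopen : IsOpen (H : Set MHat) := by
      refine Subgroup.isOpen_mono
        (H₁ := (φ : MHat →* AffineGroup S).ker ⊓ i.2.toSubgroup.comap (toAHat : MHat →* AHat)) ?_ ?_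
      · rintro m ⟨h1, h2⟩
        have h1' : φ m = 1 := h1
        change (φ m).u = ρ (toAHat m)
        rw [h1']
        refine Units.ext ?_
        change 1 = level i (gl (toAHat m))
        have h2' : ((toAHat m : AHat) : AHat ⧸ i.2.toSubgroup) = 1 :=
          (QuotientGroup.eq_one_iff _).2 h2
        rw [CompletedGroupAlgebra.level_groupLike, h2']
        rfl
      · exact ((isOpen_discrete {1}).preimage φ.continuous).inter
          (i.2.isOpen.preimage toAHat.continuous)
    have := MHat.eq_top_of_isClosed (H.isClosed_of_isOpen hopen) fun j => by
      fin_cases j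
      · exact congrArg AffineGroup.u hφ0
      · exact congrArg AffineGroup.u hφ1
    exact (this ▸ Subgroup.mem_top g : g ∈ H)
  have hc : φ basicCommutator = ⟨level i (gl (genA 0) - 1), 1⟩ := by
    rw [basicCommutator, map_commutatorElement, hφ0, hφ1, AffineGroup.commutator_eq, map_sub,
      map_one]
    rfl
  have key := eq_of_eq_gl (f₁ := fun r => φ (expC r))
    (f₂ := fun r => (⟨level i (r * (gl (genA 0) - 1)), 1⟩ : AffineGroup S))
    (fun x y => by simp [expC_add]) (fun x y => AffineGroup.ext (by simp [add_mul]) (by simp))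
    (φ.continuous.comp continuous_expC)
    (by
      have := continuous_comp_level i fun s : S =>
        (⟨s * level i (gl (genA 0) - 1), 1⟩ : AffineGroup S)
      simpa only [map_mul] using this)
    (fun g => by
      rw [expC_gl, map_mul, map_mul, hc, map_inv, AffineGroup.conj_translation, hu, map_mul]
      rfl) r
  rw [hr, map_one] at key
  rw [map_zero]
  exact (congrArg AffineGroup.v key).symm

/-! ### Coordinates on the abelianization -/

theorem AHat.eq_top_of_isClosed {H : Subgroup AHat} (hc : IsClosed (H : Set AHat))
    (hg : ∀ i, genA i ∈ H) : H = ⊤ := by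
  have := MHat.eq_top_of_isClosed (H := H.comap (toAHat : MHat →* AHat))
    (hc.preimage toAHat.continuous) hg
  rw [eq_top_iff]
  intro a _
  obtain ⟨m, rfl⟩ := toAHat_surjective a
  exact (this ▸ Subgroup.mem_top m : m ∈ H.comap (toAHat : MHat →* AHat))

theorem AHat.hom_ext {X : Type*} [Group X] [TopologicalSpace X] [T2Space X]
    {f g : AHat →ₜ* X} (h : ∀ i, f (genA i) = g (genA i)) (a : AHat) : f a = g a := by
  have : MonoidHom.eqLocus (f : AHat →* X) (g : AHat →* X) = ⊤ :=
    AHat.eq_top_of_isClosed (isClosed_eq f.continuous g.continuous) h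
  exact (this ▸ Subgroup.mem_top a : a ∈ MonoidHom.eqLocus (f : AHat →* X) (g : AHat →* X))

/-- The coordinate of `AHat` with respect to a generator, as the limit of the corresponding characters
of finite order. -/
theorem AHat.exists_coord (i : Fin 2) : ∃ κ : AHat →ₜ* Multiplicative ZHat,
    ∀ j, κ (genA j) = Multiplicative.ofAdd (Pi.single (M := fun _ => ZHat) i 1 j) := by
  choose χ hχ using fun n : ℕ+ => AHat.exists_character n (Pi.single i 1)
  have hcompat : ∀ (n m : ℕ+) (h : (n : ℕ) ∣ m) (a : AHat),
      ZMod.castHom h (ZMod n) (χ m a).toAdd = (χ n a).toAdd := by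
    intro n m h a
    let g : Multiplicative (ZMod m) →* Multiplicative (ZMod n) :=
      AddMonoidHom.toMultiplicative (ZMod.castHom h (ZMod n)).toAddMonoidHom
    let f : AHat →ₜ* Multiplicative (ZMod n) := ⟨g.comp (χ m : AHat →* Multiplicative (ZMod m)),
      continuous_def.2 fun s _ => (isOpen_discrete (g ⁻¹' s)).preimage (χ m).continuous⟩
    refine congrArg Multiplicative.toAdd (AHat.hom_ext (f := f) (g := χ n) (fun j => ?_) a)
    change Multiplicative.ofAdd (ZMod.castHom h (ZMod n) (χ m (genA j)).toAdd) = _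
    rw [hχ, hχ, toAdd_ofAdd]
    rcases eq_or_ne j i with rfl | hj
    · rw [Pi.single_eq_same, Pi.single_eq_same, map_one]
    · simp [Pi.single_eq_of_ne hj]
  let κ : AHat → ZHat := fun a => (⟨fun n => (χ n a).toAdd, fun n m h => hcompat n m h a⟩ :
    zhatSubring)
  refine ⟨⟨MonoidHom.mk' (fun a => Multiplicative.ofAdd (κ a)) fun a b => ?_, ?_⟩, fun j => ?_⟩
  · refine congrArg Multiplicative.ofAdd (ZHat.ext fun n => ?_)
    change (χ n (a * b)).toAdd = (χ n a).toAdd + (χ n b).toAdd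
    rw [map_mul, toAdd_mul]
  · have : Continuous κ := ZHat.continuous_of_mod fun n a =>
      (isOpen_discrete {Multiplicative.ofAdd a}).preimage (χ n).continuous
    exact this
  · refine congrArg Multiplicative.ofAdd (ZHat.ext fun n => ?_)
    change (χ n (genA j)).toAdd = _
    rw [hχ, toAdd_ofAdd]
    rcases eq_or_ne j i with rfl | hj
    · simp
    · simp [Pi.single_eq_of_ne hj]

/-- An element of `MHat` on which all characters of finite order vanish lies in the closed derived
subgroup: every finite abelian quotient is a quotient of a power of `ℤ/n`. -/
theorem mem_derivedMHat_of_character {κ : Fin 2 → AHat →ₜ* Multiplicative ZHat}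
    (hκ : ∀ i j, κ i (genA j) = Multiplicative.ofAdd (Pi.single (M := fun _ => ZHat) i 1 j))
    {m : MHat} (hm : ∀ i, κ i (toAHat m) = 1) : m ∈ derivedMHat := by
  change m ∈ closure (commutator MHat : Set MHat)
  rw [mem_closure_iff_nhds]
  intro s hs
  obtain ⟨t, hts, hto, hmt⟩ := mem_nhds_iff.1 hs
  obtain ⟨N, hN⟩ := ProfiniteGrp.exist_openNormalSubgroup_sub_open_nhds_of_one
    (G := MHat) (U := (fun x => m * x) ⁻¹' t)
    (hto.preimage (continuous_const.mul continuous_id)) (by simpa using hmt)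
  have : Finite (MHat ⧸ N.toSubgroup) := Subgroup.quotient_finite_of_isOpen _ N.isOpen'
  let B := Abelianization (MHat ⧸ N.toSubgroup)
  have : Finite B := Quotient.finite _
  let π : MHat →* B := Abelianization.of.comp (QuotientGroup.mk' N.toSubgroup)
  let n : ℕ+ := ⟨Nat.card B, Nat.card_pos⟩
  let χ (i : Fin 2) : MHat →* Multiplicative (ZMod n) :=
    (AddMonoidHom.toMultiplicative (ZHat.mod n).toAddMonoidHom).comp
      ((κ i : AHat →* Multiplicative ZHat).comp (toAHat : MHat →* AHat))
  have hn : ∀ b : Additive B, zmultiplesHom (Additive B) b n = 0 := by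
    intro b
    rw [zmultiplesHom_apply, natCast_zsmul]
    exact pow_card_eq_one' (G := B) (x := b.toMul)
  let θ (i : Fin 2) : Multiplicative (ZMod n) →* B := AddMonoidHom.toMultiplicativeLeft
    (ZMod.lift n ⟨zmultiplesHom (Additive B) (Additive.ofMul (π (gen i))), hn _⟩)
  have hθ : ∀ i, θ i (Multiplicative.ofAdd 1) = π (gen i) := by
    intro i
    have := ZMod.lift_coe (n : ℕ) ⟨zmultiplesHom (Additive B) (Additive.ofMul (π (gen i))), hn _⟩ 1
    rw [Int.cast_one] at this
    exact (congrArg Additive.toMul this).trans (zpow_one (π (gen i)))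
  -- Modulo `N` and commutators, `x` is the product of the powers `gen i ^ χ i x`.
  let H : Subgroup MHat := MonoidHom.eqLocus π ((θ 0).comp (χ 0) * (θ 1).comp (χ 1))
  have hopen : IsOpen (H : Set MHat) := by
    refine Subgroup.isOpen_mono (H₁ := N.toSubgroup ⊓ ((χ 0).ker ⊓ (χ 1).ker)) ?_ ?_
    · rintro x ⟨h1, h2, h3⟩
      have h1' : π x = 1 := by
        change Abelianization.of (x : MHat ⧸ N.toSubgroup) = 1
        rw [(QuotientGroup.eq_one_iff x).2 h1, map_one]
      change π x = θ 0 (χ 0 x) * θ 1 (χ 1 x)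
      rw [MonoidHom.mem_ker.1 h2, MonoidHom.mem_ker.1 h3, h1', map_one, map_one, mul_one]
    · have hχ : ∀ i, IsOpen ((χ i).ker : Set MHat) := fun i =>
        (ZHat.isOpen_mod_eq n 0).preimage ((κ i).continuous.comp toAHat.continuous)
      exact N.isOpen'.inter ((hχ 0).inter (hχ 1))
  have hχg : ∀ i j,
      χ i (gen j) = Multiplicative.ofAdd (Pi.single (M := fun _ => ZMod n) i 1 j) := by
    intro i j
    change Multiplicative.ofAdd (ZHat.mod n (κ i (genA j)).toAdd) = _
    rw [hκ, toAdd_ofAdd]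
    rcases eq_or_ne j i with rfl | hj
    · simp
    · simp [Pi.single_eq_of_ne hj]
  have htop : H = ⊤ := MHat.eq_top_of_isClosed (H.isClosed_of_isOpen hopen) fun j => by
    change π (gen j) = θ 0 (χ 0 (gen j)) * θ 1 (χ 1 (gen j))
    rw [hχg, hχg]
    fin_cases j
    · simp [hθ]
    · simp [hθ]
  have hχm : ∀ i, χ i m = 1 := by
    intro i
    change Multiplicative.ofAdd (ZHat.mod n (κ i (toAHat m)).toAdd) = 1
    rw [hm, toAdd_one, map_zero, ofAdd_zero]
  have hmH : π m = θ 0 (χ 0 m) * θ 1 (χ 1 m) := (htop ▸ Subgroup.mem_top m : m ∈ H)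
  rw [hχm, hχm, map_one, map_one, mul_one] at hmH
  have hcomm : (m : MHat ⧸ N.toSubgroup) ∈ commutator (MHat ⧸ N.toSubgroup) :=
    (QuotientGroup.eq_one_iff _).1 hmH
  have hmap : commutator (MHat ⧸ N.toSubgroup) =
      (commutator MHat).map (QuotientGroup.mk' N.toSubgroup) := by
    rw [commutator_def, commutator_def, Subgroup.map_commutator, ← MonoidHom.range_eq_map,
      MonoidHom.range_eq_top.2 (QuotientGroup.mk'_surjective _)]
  rw [hmap] at hcomm
  obtain ⟨d, hd, hdm⟩ := hcomm
  refine ⟨d, hts ?_, hd⟩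
  have h1 := hN (QuotientGroup.eq.1 hdm.symm)
  simpa using h1

/-- A continuous additive map out of `ZHat ^ 2` is determined by the images of the basis vectors. -/
theorem zhatPi_hom_ext {X : Type*} [AddCommGroup X] [TopologicalSpace X] [T2Space X]
    {f g : (Fin 2 → ZHat) →+ X} (hf : Continuous f) (hg : Continuous g)
    (h : ∀ i, f (Pi.single i 1) = g (Pi.single i 1)) : f = g := by
  refine AddMonoidHom.functions_ext _ _ _ fun i z => ?_
  have hs : Continuous fun z => Pi.single (M := fun _ : Fin 2 => ZHat) i z :=
    continuous_single (A := fun _ => ZHat) i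
  let ι : ZHat →+ (Fin 2 → ZHat) := AddMonoidHom.single (fun _ => ZHat) i
  exact ZHat.eq_top_of_isClosed (H := AddMonoidHom.eqLocus (f.comp ι) (g.comp ι))
    (isClosed_eq (hf.comp hs) (hg.comp hs)) (h i) z

/-- The abelianization of `MHat` is free on the classes of the generators. -/
theorem exists_basis : ∃ e : (Fin 2 → ZHat) ≃ₜ+ Additive AHat,
    ∀ i, e (Pi.single i 1) = Additive.ofMul (genA i) := by
  choose κ hκ using AHat.exists_coord
  let f : Additive AHat →+ (Fin 2 → ZHat) :=
    AddMonoidHom.mk' (fun a i => (κ i a.toMul).toAdd) fun a b => by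
      funext i
      simp
  have hf : Continuous f := continuous_pi fun i => (κ i).continuous
  have hfg : ∀ i, f (Additive.ofMul (genA i)) = Pi.single i 1 := by
    intro i
    funext j
    change (κ j (genA i)).toAdd = _
    rw [hκ, toAdd_ofAdd]
    rcases eq_or_ne i j with rfl | hj
    · simp
    · simp [Pi.single_eq_of_ne hj, Pi.single_eq_of_ne hj.symm]
  have hinj : Function.Injective f := by
    rw [injective_iff_map_eq_zero]
    intro a ha
    obtain ⟨m, hm⟩ := toAHat_surjective a.toMul
    have := mem_derivedMHat_of_character (κ := κ) hκ (m := m) fun i => by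
      rw [hm]
      exact congrFun ha i
    rw [← toAHat_eq_one_iff, hm] at this
    exact this
  have : CompactSpace (Additive AHat) := (inferInstance : CompactSpace AHat)
  have hsurj : Function.Surjective f := by
    intro v
    have hc : IsClosed (f.range : Set (Fin 2 → ZHat)) := (isCompact_range hf).isClosed
    have h1 : ∀ i z, Pi.single i z ∈ f.range := fun i z =>
      ZHat.eq_top_of_isClosed
        (H := f.range.comap (AddMonoidHom.single (fun _ : Fin 2 => ZHat) i))
        (hc.preimage (continuous_single (A := fun _ => ZHat) i)) ⟨_, hfg i⟩ z
    have : v ∈ f.range := by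
      rw [← Finset.univ_sum_single v]
      exact sum_mem fun i _ => h1 i _
    exact this
  let F := AddEquiv.ofBijective f ⟨hinj, hsurj⟩
  let h := Continuous.homeoOfEquivCompactToT2 (f := F.toEquiv) hf
  refine ⟨{ F.symm with
    continuous_toFun := h.symm.continuous
    continuous_invFun := h.continuous }, fun i => ?_⟩
  exact F.symm_apply_eq.2 (hfg i).symm

/-! ### Matrices of automorphisms of the abelianization -/

theorem exists_matrix {f : (Fin 2 → ZHat) →+ (Fin 2 → ZHat)} (hf : Continuous f) :
    ∃ A : Matrix (Fin 2) (Fin 2) ZHat, ∀ v, f v = A *ᵥ v := by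
  let A : Matrix (Fin 2) (Fin 2) ZHat := Matrix.of fun i j => f (Pi.single j 1) i
  refine ⟨A, fun v => ?_⟩
  refine DFunLike.congr_fun (zhatPi_hom_ext (g := A.mulVecLin.toAddMonoidHom) hf ?_ fun j => ?_) v
  · exact continuous_const.matrix_mulVec continuous_id
  · change _ = A *ᵥ Pi.single j 1
    rw [Matrix.mulVec_single_one]
    rfl

theorem matrix_ext {A B : Matrix (Fin 2) (Fin 2) ZHat} (h : ∀ v, A *ᵥ v = B *ᵥ v) : A = B :=
  Matrix.mulVec_injective (funext h)

section

variable {e e' : (Fin 2 → ZHat) ≃ₜ+ Additive AHat} {σ τ : AHat ≃ₜ* AHat} {A B : GL (Fin 2) ZHat}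

theorem HasMatrix.unique (hA : HasMatrix e σ A) (hB : HasMatrix e σ B) : A = B :=
  Units.ext (matrix_ext fun v => e.injective ((hA v).symm.trans (hB v)))

theorem HasMatrix.ext (hA : HasMatrix e σ A) (hB : HasMatrix e τ A) : σ = τ := by
  ext a
  have h := (hA (e.symm (Additive.ofMul a))).trans (hB (e.symm (Additive.ofMul a))).symm
  simpa using h

theorem HasMatrix.mul (hA : HasMatrix e σ A) (hB : HasMatrix e τ B) :
    HasMatrix e (σ * τ) (A * B) := by
  intro v
  change Additive.ofMul (σ (τ (e v).toMul)) = _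
  have h1 : τ (e v).toMul = (e (B.val *ᵥ v)).toMul := hB v
  rw [h1, hA, Units.val_mul, Matrix.mulVec_mulVec]

theorem HasMatrix.one : HasMatrix e 1 1 := by
  intro v
  rw [Units.val_one, Matrix.one_mulVec]
  rfl

theorem exists_matrix_of_hom {e : (Fin 2 → ZHat) ≃ₜ+ Additive AHat} (f : AHat →ₜ* AHat) :
    ∃ A : Matrix (Fin 2) (Fin 2) ZHat, ∀ v, Additive.ofMul (f (e v).toMul) = e (A *ᵥ v) := by
  let g : (Fin 2 → ZHat) →+ (Fin 2 → ZHat) :=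
    AddMonoidHom.mk' (fun v => e.symm (Additive.ofMul (f (e v).toMul))) fun v w => by simp
  have hg : Continuous g := e.symm.continuous.comp (f.continuous.comp e.continuous)
  obtain ⟨A, hA⟩ := exists_matrix hg
  refine ⟨A, fun v => ?_⟩
  rw [← hA]
  exact (e.apply_symm_apply _).symm

theorem exists_hasMatrix (e : (Fin 2 → ZHat) ≃ₜ+ Additive AHat) (σ : AHat ≃ₜ* AHat) :
    ∃ A, HasMatrix e σ A := by
  obtain ⟨A, hA⟩ := exists_matrix_of_hom (e := e) (σ : AHat →ₜ* AHat)
  obtain ⟨B, hB⟩ := exists_matrix_of_hom (e := e) (σ.symm : AHat →ₜ* AHat)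
  refine ⟨⟨A, B, matrix_ext fun v => ?_, matrix_ext fun v => ?_⟩, hA⟩
  · rw [Matrix.one_mulVec, ← Matrix.mulVec_mulVec]
    apply e.injective
    rw [← hA, ← hB]
    exact congrArg Additive.ofMul (σ.apply_symm_apply _)
  · rw [Matrix.one_mulVec, ← Matrix.mulVec_mulVec]
    apply e.injective
    rw [← hB, ← hA]
    exact congrArg Additive.ofMul (σ.symm_apply_apply _)

/-- The determinant does not depend on the basis. -/
theorem HasMatrix.det_eq (hA : HasMatrix e σ A) (hB : HasMatrix e' σ B) :
    GeneralLinearGroup.det A = GeneralLinearGroup.det B := by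
  obtain ⟨P, hP⟩ := exists_matrix (f := ((e'.toAddEquiv.trans e.symm.toAddEquiv) : _ →+ _))
    (e.symm.continuous.comp e'.continuous)
  obtain ⟨P', hP'⟩ := exists_matrix (f := ((e.toAddEquiv.trans e'.symm.toAddEquiv) : _ →+ _))
    (e'.symm.continuous.comp e.continuous)
  have hPe : ∀ v, e (P *ᵥ v) = e' v := by
    intro v
    rw [← hP]
    exact e.apply_symm_apply _
  have hPe' : ∀ v, e' (P' *ᵥ v) = e v := by
    intro v
    rw [← hP']
    exact e'.apply_symm_apply _
  have h1 : P * P' = 1 := matrix_ext fun v => e.injective <| by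
    rw [← Matrix.mulVec_mulVec, hPe, hPe', Matrix.one_mulVec]
  have h2 : A.val * P = P * B.val := matrix_ext fun v => e.injective <| by
    rw [← Matrix.mulVec_mulVec, ← Matrix.mulVec_mulVec, ← hA, hPe, hPe, ← hB]
  have h3 := congrArg Matrix.det h2
  have h4 := congrArg Matrix.det h1
  rw [Matrix.det_mul, Matrix.det_mul, mul_comm] at h3
  rw [Matrix.det_mul, Matrix.det_one, mul_comm] at h4
  ext
  change A.val.det = B.val.det
  calc A.val.det = P'.det * P.det * A.val.det := by rw [h4, one_mul]
    _ = P'.det * P.det * B.val.det := by rw [mul_assoc, h3, mul_assoc]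
    _ = B.val.det := by rw [h4, one_mul]

theorem HasDet.eq {u : ZHatˣ} (h : HasDet σ u) (hA : HasMatrix e σ A) :
    u = GeneralLinearGroup.det A := by
  obtain ⟨e', A', h', rfl⟩ := h
  exact h'.det_eq hA

end

/-! ### Endomorphisms and their determinants -/

theorem commutator_expC_mul {y z : MHat} {α : CompletedGroupAlgebra AHat} (h : ⁅y, z⁆ = expC α)
    (r s : CompletedGroupAlgebra AHat) :
    ⁅expC r * y, expC s * z⁆ =
      expC (α + (1 - gl (toAHat z)) * r + (gl (toAHat y) - 1) * s) := by
  have h1 : ⁅expC r * y, expC s * z⁆ =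
      expC r * (y * expC s * y⁻¹) * ⁅y, z⁆ * (z * (expC r)⁻¹ * z⁻¹) * (expC s)⁻¹ := by
    simp only [commutatorElement_def]
    group
  rw [h1, h, ← expC_neg, ← expC_neg, conj_expC, conj_expC, ← expC_add, ← expC_add, ← expC_add,
    ← expC_add]
  congr 1
  ring

theorem exists_eq_expC_mul {x y : MHat} (h : toAHat y = toAHat x) : ∃ r, y = expC r * x := by
  have h1 : y * x⁻¹ ∈ derivedMHat := by
    rw [← toAHat_eq_one_iff, map_mul, map_inv, h, mul_inv_cancel]
  obtain ⟨r, hr⟩ := mem_derivedMHat_iff.1 h1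
  exact ⟨r, by rw [hr, inv_mul_cancel_right]⟩

/-- An endomorphism that is trivial on the abelianization and sends the basic commutator to a
conjugate is inner: after conjugation it fixes the commutator, and then the first-order changes of
the generators form a Koszul cycle, hence a boundary. -/
theorem exists_eq_conj {f : MHat →ₜ* MHat} (hf : ∀ m, toAHat (f m) = toAHat m) {g : MHat}
    (hc : f basicCommutator = g * basicCommutator * g⁻¹) : ∃ k, ∀ m, f m = k * m * k⁻¹ := by
  have hf' : ∀ m, toAHat (g⁻¹ * f m * g) = toAHat m := by
    intro m
    rw [map_mul, map_mul, map_inv, hf, mul_comm, mul_inv_cancel_left]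
  obtain ⟨r, hr⟩ := exists_eq_expC_mul (hf' (gen 0))
  obtain ⟨s, hs⟩ := exists_eq_expC_mul (hf' (gen 1))
  have h1 : ⁅g⁻¹ * f (gen 0) * g, g⁻¹ * f (gen 1) * g⁆ = expC 1 := by
    have h2 : ⁅g⁻¹ * f (gen 0) * g, g⁻¹ * f (gen 1) * g⁆ = g⁻¹ * ⁅f (gen 0), f (gen 1)⁆ * g := by
      simp only [commutatorElement_def]
      group
    rw [h2, ← map_commutatorElement]
    change g⁻¹ * f basicCommutator * g = _
    rw [hc, expC_one]
    group
  rw [hr, hs, commutator_expC_mul (α := 1) expC_one.symm] at h1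
  have h3 := expC_injective h1
  obtain ⟨t, h4, h5⟩ := CompletedGroupAlgebra.koszul_exact (a := genA 0) (b := genA 1)
    (r := s) (s := -r)
    (fun N => by
      obtain ⟨χ, hχ⟩ := AHat.exists_character N fun _ => 1
      exact ⟨χ, hχ 0⟩)
    (fun N => by
      obtain ⟨χ, hχ⟩ := AHat.exists_character N ![0, 1]
      exact ⟨χ, hχ 1, (hχ 0).trans ofAdd_zero⟩)
    (by linear_combination h3)
  have hconj : ∀ x, expC t * x * (expC t)⁻¹ = expC (t - gl (toAHat x) * t) * x := by
    intro x
    rw [sub_eq_add_neg, expC_add, expC_neg, ← conj_expC]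
    group
  refine ⟨g * expC t, fun m => ?_⟩
  have hH := MHat.eq_top_of_isClosed
    (H := MonoidHom.eqLocus (f : MHat →* MHat) (MulAut.conj (g * expC t)).toMonoidHom)
    (isClosed_eq f.continuous (by
      change Continuous fun x => g * expC t * x * (g * expC t)⁻¹
      fun_prop)) fun i => by
    change f (gen i) = g * expC t * gen i * (g * expC t)⁻¹
    have key : g⁻¹ * f (gen i) * g = expC t * gen i * (expC t)⁻¹ := by
      rw [hconj]
      fin_cases i
      · refine hr.trans ?_
        rw [show r = t - gl (genA 0) * t by linear_combination -h4]
        rfl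
      · refine hs.trans ?_
        rw [show s = t - gl (genA 1) * t by linear_combination h5]
        rfl
    have h6 : f (gen i) = g * (g⁻¹ * f (gen i) * g) * g⁻¹ := by group
    rw [h6, key]
    group
  exact (hH ▸ Subgroup.mem_top m :
    m ∈ MonoidHom.eqLocus (f : MHat →* MHat) (MulAut.conj (g * expC t)).toMonoidHom)

theorem map_expC_scalarHom {f : MHat →ₜ* MHat} {α : CompletedGroupAlgebra AHat}
    (hf : f basicCommutator = expC α) (u : ZHat) :
    f (expC (scalarHom AHat u)) = expC (scalarHom AHat u * α) := by
  let f₁ : ZHat →+ Additive MHat :=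
    ((MonoidHom.toAdditive (f : MHat →* MHat)).comp expAdd).comp (scalarHom AHat).toAddMonoidHom
  let f₂ : ZHat →+ Additive MHat :=
    (expAdd.comp (AddMonoidHom.mulRight α)).comp (scalarHom AHat).toAddMonoidHom
  have : T2Space (Additive MHat) := (inferInstance : T2Space MHat)
  refine congrArg Additive.toMul (ZHat.eq_top_of_isClosed (H := AddMonoidHom.eqLocus f₁ f₂)
    (isClosed_eq ?_ ?_) ?_ u)
  · exact f.continuous.comp (continuous_expC.comp CompletedGroupAlgebra.continuous_scalarHom)
  · exact continuous_expC.comp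
      (CompletedGroupAlgebra.continuous_scalarHom.mul continuous_const)
  · change f (expC (scalarHom AHat 1)) = expC (scalarHom AHat 1 * α)
    rw [map_one, one_mul, expC_one, hf]

/-! ### The determinant modulo the augmentation ideal -/

/-- The Heisenberg group of a ring: upper unitriangular matrices of size `3`. -/
@[ext]
structure HeisenbergGroup (R : Type*) where
  /-- The first coordinate of the abelianization. -/
  p : R
  /-- The second coordinate of the abelianization. -/
  q : R
  /-- The central coordinate. -/
  z : R

namespace HeisenbergGroup

variable {R : Type*} [CommRing R]

instance : Mul (HeisenbergGroup R) := ⟨fun x y => ⟨x.p + y.p, x.q + y.q, x.z + y.z + x.p * y.q⟩⟩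
instance : One (HeisenbergGroup R) := ⟨⟨0, 0, 0⟩⟩
instance : Inv (HeisenbergGroup R) := ⟨fun x => ⟨-x.p, -x.q, -x.z + x.p * x.q⟩⟩

@[simp] theorem mul_p (x y : HeisenbergGroup R) : (x * y).p = x.p + y.p := rfl
@[simp] theorem mul_q (x y : HeisenbergGroup R) : (x * y).q = x.q + y.q := rfl
@[simp] theorem mul_z (x y : HeisenbergGroup R) : (x * y).z = x.z + y.z + x.p * y.q := rfl
@[simp] theorem one_p : (1 : HeisenbergGroup R).p = 0 := rfl
@[simp] theorem one_q : (1 : HeisenbergGroup R).q = 0 := rfl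
@[simp] theorem one_z : (1 : HeisenbergGroup R).z = 0 := rfl
@[simp] theorem inv_p (x : HeisenbergGroup R) : x⁻¹.p = -x.p := rfl
@[simp] theorem inv_q (x : HeisenbergGroup R) : x⁻¹.q = -x.q := rfl
@[simp] theorem inv_z (x : HeisenbergGroup R) : x⁻¹.z = -x.z + x.p * x.q := rfl

instance : Group (HeisenbergGroup R) where
  mul_assoc x y z := by ext <;> simp <;> ring
  one_mul x := by ext <;> simp
  mul_one x := by ext <;> simp
  inv_mul_cancel x := by ext <;> simp

theorem commutator_eq (x y : HeisenbergGroup R) :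
    ⁅x, y⁆ = (⟨0, 0, x.p * y.q - x.q * y.p⟩ : HeisenbergGroup R) := by
  rw [commutatorElement_def]
  ext <;> simp
  ring

/-- The projection to the abelianization. -/
def toProd : HeisenbergGroup R →* Multiplicative (Fin 2 → R) where
  toFun x := Multiplicative.ofAdd ![x.p, x.q]
  map_one' := by
    rw [one_p, one_q, ← ofAdd_zero]
    congr 1
    ext i
    fin_cases i <;> rfl
  map_mul' x y := by
    rw [mul_p, mul_q, ← ofAdd_add]
    congr 1
    ext i
    fin_cases i <;> rfl

theorem derivedSeries_two : derivedSeries (HeisenbergGroup R) 2 = ⊥ := by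
  refine derivedSeries_two_eq_bot_of_comm fun a ha b hb => ?_
  have h : ∀ x ∈ commutator (HeisenbergGroup R), x.p = 0 ∧ x.q = 0 := by
    intro x hx
    have := congrArg Multiplicative.toAdd
      (MonoidHom.mem_ker.1 (Abelianization.commutator_subset_ker (toProd (R := R)) hx))
    exact ⟨congrFun this 0, congrFun this 1⟩
  ext <;> simp [h a ha, h b hb, add_comm]

instance [Finite R] : Finite (HeisenbergGroup R) :=
  Finite.of_injective (fun x : HeisenbergGroup R => (x.p, x.q, x.z)) fun _ _ h =>
    HeisenbergGroup.ext (congrArg Prod.fst h) (congrArg (fun t => t.2.1) h)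
      (congrArg (fun t => t.2.2) h)

end HeisenbergGroup

theorem level_top_eq_single (n : ℕ+) (f : MonoidAlgebra (ZMod n)
    (AHat ⧸ (⊤ : OpenSubgroup AHat).toSubgroup)) :
    f = MonoidAlgebra.single 1 (f.coeff 1) := by
  have h : ∀ x : AHat ⧸ (⊤ : OpenSubgroup AHat).toSubgroup, x = 1 := by
    intro x
    obtain ⟨x, rfl⟩ := QuotientGroup.mk_surjective x
    exact (QuotientGroup.eq_one_iff x).2 trivial
  ext x
  rw [h x]
  simp

/-- If `[y, z] = c ^ α`, then the augmentation of `α` is the determinant of the classes of `y`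
and `z`, as seen in the Heisenberg groups over `ℤ/n`. -/
theorem level_top_eq_det {e : (Fin 2 → ZHat) ≃ₜ+ Additive AHat}
    (he : ∀ i, e (Pi.single i 1) = Additive.ofMul (genA i)) {v w : Fin 2 → ZHat} {y z : MHat}
    (hv : e v = Additive.ofMul (toAHat y)) (hw : e w = Additive.ofMul (toAHat z))
    {α : CompletedGroupAlgebra AHat} (h : ⁅y, z⁆ = expC α) (n : ℕ+) :
    level (n, ⊤) α = level (n, ⊤) (scalarHom AHat (v 0 * w 1 - v 1 * w 0)) := by
  let _ : TopologicalSpace (HeisenbergGroup (ZMod n)) := ⊥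
  have : DiscreteTopology (HeisenbergGroup (ZMod n)) := ⟨rfl⟩
  obtain ⟨φ, hφ⟩ := MHat.exists_lift (HeisenbergGroup.derivedSeries_two (R := ZMod n))
    ![⟨1, 0, 0⟩, ⟨0, 1, 0⟩]
  have hφ0 : φ (gen 0) = ⟨1, 0, 0⟩ := hφ 0
  have hφ1 : φ (gen 1) = ⟨0, 1, 0⟩ := hφ 1
  have hc : φ basicCommutator = ⟨0, 0, 1⟩ := by
    rw [basicCommutator, map_commutatorElement, HeisenbergGroup.commutator_eq, hφ0, hφ1]
    ext <;> simp
  have hexp : φ (expC α) = ⟨0, 0, (level (n, ⊤) α).coeff 1⟩ := by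
    refine eq_of_eq_gl (f₁ := fun r => φ (expC r))
      (f₂ := fun r => (⟨0, 0, (level (n, ⊤) r).coeff 1⟩ : HeisenbergGroup (ZMod n)))
      (fun x y => by rw [expC_add, map_mul]) (fun x y => by ext <;> simp)
      (φ.continuous.comp continuous_expC)
      (continuous_comp_level (n, ⊤) fun s => (⟨0, 0, s.coeff 1⟩ : HeisenbergGroup (ZMod n)))
      (fun g => ?_) α
    rw [expC_gl, map_mul, map_mul, hc, map_inv, level_top_eq_single n (level (n, ⊤) _),
      CompletedGroupAlgebra.level_groupLike]
    have h1 : ((toAHat g : AHat) : AHat ⧸ (⊤ : OpenSubgroup AHat).toSubgroup) = 1 :=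
      (QuotientGroup.eq_one_iff _).2 trivial
    rw [h1]
    ext
    · simp
    · simp
    · simp only [HeisenbergGroup.mul_z, HeisenbergGroup.inv_z, HeisenbergGroup.mul_p,
        HeisenbergGroup.inv_q, MonoidAlgebra.coeff_single, Finsupp.single_eq_same]
      ring
  let κ : MHat →ₜ* Multiplicative (Fin 2 → ZMod n) :=
    ⟨HeisenbergGroup.toProd.comp (φ : MHat →* HeisenbergGroup (ZMod n)),
      continuous_def.2 fun s _ => (isOpen_discrete (HeisenbergGroup.toProd ⁻¹' s)).preimage
        φ.continuous⟩
  let κ' : MHat →ₜ* Multiplicative (Fin 2 → ZMod n) :=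
    ⟨MonoidHom.mk' (fun m => Multiplicative.ofAdd fun i =>
      ZHat.mod n (e.symm (Additive.ofMul (toAHat m)) i)) fun a b => by
        rw [← ofAdd_add]
        congr 1
        funext i
        simp,
      continuous_pi fun i => continuous_discrete_rng.2 fun a =>
        (ZHat.isOpen_mod_eq n a).preimage ((continuous_apply i).comp
          (e.symm.continuous.comp toAHat.continuous))⟩
  have hκ : κ = κ' := MHat.hom_ext fun i => by
    have h1 : e.symm (Additive.ofMul (toAHat (gen i))) = Pi.single i 1 := by
      rw [← he, e.symm_apply_apply]
    change Multiplicative.ofAdd ![(φ (gen i)).p, (φ (gen i)).q] = Multiplicative.ofAdd fun j =>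
      ZHat.mod n (e.symm (Additive.ofMul (toAHat (gen i))) j)
    rw [h1]
    congr 1
    funext j
    fin_cases i <;> fin_cases j <;> simp [hφ0, hφ1]
  have hcoord : ∀ {v : Fin 2 → ZHat} {y : MHat}, e v = Additive.ofMul (toAHat y) →
      (φ y).p = ZHat.mod n (v 0) ∧ (φ y).q = ZHat.mod n (v 1) := by
    intro v y hv
    have h1 := congrArg Multiplicative.toAdd (DFunLike.congr_fun hκ y)
    have h2 : e.symm (Additive.ofMul (toAHat y)) = v := by rw [← hv, e.symm_apply_apply]
    constructor
    · rw [← h2]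
      exact congrFun h1 0
    · rw [← h2]
      exact congrFun h1 1
  rw [← h, map_commutatorElement, HeisenbergGroup.commutator_eq] at hexp
  have hdet : (φ y).p * (φ z).q - (φ y).q * (φ z).p = (level (n, ⊤) α).coeff 1 :=
    congrArg HeisenbergGroup.z hexp
  rw [level_top_eq_single n (level (n, ⊤) α), ← hdet, CompletedGroupAlgebra.level_scalarHom]
  simp [hcoord hv, hcoord hw]

theorem zhatPi_eq_top {H : AddSubgroup (Fin 2 → ZHat)} (hc : IsClosed (H : Set (Fin 2 → ZHat)))
    (h : ∀ i, Pi.single i 1 ∈ H) (v : Fin 2 → ZHat) : v ∈ H := by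
  rw [← Finset.univ_sum_single v]
  exact sum_mem fun i _ => ZHat.eq_top_of_isClosed
    (H := H.comap (AddMonoidHom.single (fun _ : Fin 2 => ZHat) i))
    (hc.preimage (continuous_single (A := fun _ => ZHat) i)) (h i) (v i)

/-- Every matrix is realized by an endomorphism with the expected scalar determinant: the
determinant of an arbitrary lift is correct modulo the augmentation ideal, and multiplying the
images of the generators by powers of the basic commutator changes it by any element of that
ideal. -/
theorem exists_endo_of_matrix {e : (Fin 2 → ZHat) ≃ₜ+ Additive AHat}
    (he : ∀ i, e (Pi.single i 1) = Additive.ofMul (genA i)) (A : GL (Fin 2) ZHat) :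
    ∃ f : MHat →ₜ* MHat,
      (∀ v m, e v = Additive.ofMul (toAHat m) → e (A.val *ᵥ v) = Additive.ofMul (toAHat (f m))) ∧
      f basicCommutator = expC (scalarHom AHat A.val.det) := by
  choose y hy using fun i : Fin 2 => toAHat_surjective (e (A.val *ᵥ Pi.single i 1)).toMul
  have hy' : ∀ i, e (A.val *ᵥ Pi.single i 1) = Additive.ofMul (toAHat (y i)) := fun i =>
    congrArg Additive.ofMul (hy i).symm
  obtain ⟨α, hα⟩ := mem_derivedMHat_iff.1 (commutator_mem_derivedMHat (y 0) (y 1))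
  have hdet : ∀ n, level (n, ⊤) (scalarHom AHat A.val.det - α) = 0 := by
    intro n
    rw [map_sub, level_top_eq_det he (hy' 0) (hy' 1) hα.symm, sub_eq_zero]
    congr 2
    rw [Matrix.det_fin_two]
    simp only [Matrix.mulVec_single_one, Matrix.col_apply]
    ring
  obtain ⟨u, w, huw⟩ := CompletedGroupAlgebra.exists_eq_of_augmentation_eq_zero
    (b := toAHat (y 0)) (b' := toAHat (y 1)) (fun H hH h0 h1 => by
      rw [eq_top_iff]
      intro a _
      let L : AddSubgroup (Fin 2 → ZHat) := (Subgroup.toAddSubgroup H).comap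
        ((e : (Fin 2 → ZHat) →+ Additive AHat).comp A.val.mulVecLin.toAddMonoidHom)
      have hL := zhatPi_eq_top (H := L)
        (hH.preimage (e.continuous.comp (continuous_const.matrix_mulVec continuous_id)))
        (fun i => by
          change e (A.val *ᵥ Pi.single i 1) ∈ Subgroup.toAddSubgroup H
          rw [hy']
          fin_cases i
          · exact h0
          · exact h1) (A⁻¹.val *ᵥ e.symm (Additive.ofMul a))
      have h2 : e (A.val *ᵥ (A⁻¹.val *ᵥ e.symm (Additive.ofMul a))) ∈ Subgroup.toAddSubgroup H := hL
      rw [Matrix.mulVec_mulVec, Units.mul_inv, Matrix.one_mulVec, e.apply_symm_apply] at h2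
      exact h2) hdet
  obtain ⟨f, hf⟩ := MHat.exists_endo ![expC (-w) * y 0, expC u * y 1]
  have hf0 : f (gen 0) = expC (-w) * y 0 := hf 0
  have hf1 : f (gen 1) = expC u * y 1 := hf 1
  refine ⟨f, ?_, ?_⟩
  · intro v m hvm
    let κ : (Fin 2 → ZHat) →+ Additive AHat :=
      (e : (Fin 2 → ZHat) →+ Additive AHat).comp A.val.mulVecLin.toAddMonoidHom
    have hκ : Continuous κ :=
      e.continuous.comp (continuous_const.matrix_mulVec continuous_id)
    let κ' : MHat →ₜ* AHat := ⟨MonoidHom.mk'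
      (fun m => (κ (e.symm (Additive.ofMul (toAHat m)))).toMul) fun a b => by simp, hκ.comp (e.symm.continuous.comp toAHat.continuous)⟩
    have h : κ' = toAHat.comp f := MHat.hom_ext fun i => by
      change (e (A.val *ᵥ e.symm (Additive.ofMul (toAHat (gen i))))).toMul = toAHat (f (gen i))
      rw [← he, e.symm_apply_apply, ← hy]
      fin_cases i
      · change _ = toAHat (f (gen 0))
        rw [hf0, map_mul, toAHat_eq_one_iff.2 (expC_mem _), one_mul]
        rfl
      · change _ = toAHat (f (gen 1))
        rw [hf1, map_mul, toAHat_eq_one_iff.2 (expC_mem _), one_mul]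
        rfl
    have h1 : (e (A.val *ᵥ e.symm (Additive.ofMul (toAHat m)))).toMul = toAHat (f m) :=
      DFunLike.congr_fun h m
    rw [← hvm, e.symm_apply_apply] at h1
    exact congrArg Additive.ofMul h1
  · rw [basicCommutator, map_commutatorElement, hf0, hf1, commutator_expC_mul hα.symm]
    congr 1
    linear_combination huw

/-- A continuous bijective endomorphism of `MHat` is an automorphism of topological groups. -/
def MHat.equivOfBijective (f : MHat →ₜ* MHat) (hf : Function.Bijective f) : MHat ≃ₜ* MHat :=
  { MulEquiv.ofBijective f hf with
    continuous_toFun := f.continuous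
    continuous_invFun := (Continuous.homeoOfEquivCompactToT2 (f := Equiv.ofBijective f hf)
      f.continuous).symm.continuous }

theorem exists_aut_of_matrix {e : (Fin 2 → ZHat) ≃ₜ+ Additive AHat}
    (he : ∀ i, e (Pi.single i 1) = Additive.ofMul (genA i)) (A : GL (Fin 2) ZHat) :
    ∃ g : MHat ≃ₜ* MHat, HasMatrix e (abAut MHat g) A ∧
      g basicCommutator = expC (scalarHom AHat A.val.det) := by
  -- The endomorphisms attached to a matrix and its inverse compose to inner automorphisms.
  have key : ∀ (A : GL (Fin 2) ZHat) (f f' : MHat →ₜ* MHat),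
      (∀ v m, e v = Additive.ofMul (toAHat m) → e (A.val *ᵥ v) = Additive.ofMul (toAHat (f m))) →
      f basicCommutator = expC (scalarHom AHat A.val.det) →
      (∀ v m, e v = Additive.ofMul (toAHat m) →
        e (A⁻¹.val *ᵥ v) = Additive.ofMul (toAHat (f' m))) →
      f' basicCommutator = expC (scalarHom AHat A⁻¹.val.det) →
      ∃ k, ∀ m, f (f' m) = k * m * k⁻¹ := by
    intro A f f' hf hfc hf' hfc'
    refine exists_eq_conj (f := f.comp f') (g := 1) (fun m => ?_) ?_
    · have h0 : e (e.symm (Additive.ofMul (toAHat m))) = Additive.ofMul (toAHat m) :=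
        e.apply_symm_apply _
      have h1 := hf _ _ (hf' _ _ h0)
      rw [Matrix.mulVec_mulVec, Units.mul_inv, Matrix.one_mulVec, h0] at h1
      exact (congrArg Additive.toMul h1).symm
    · change f (f' basicCommutator) = _
      rw [hfc', map_expC_scalarHom hfc, ← map_mul, ← Matrix.det_mul, Units.inv_mul,
        Matrix.det_one, map_one, expC_one]
      group
  obtain ⟨f, hf, hfc⟩ := exists_endo_of_matrix he A
  obtain ⟨f', hf', hfc'⟩ := exists_endo_of_matrix he A⁻¹
  obtain ⟨k, hk⟩ := key A f f' hf hfc hf' hfc'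
  obtain ⟨k', hk'⟩ := key A⁻¹ f' f hf' hfc' (by rwa [inv_inv]) (by rwa [inv_inv])
  have hbij : Function.Bijective f := by
    constructor
    · intro a b hab
      have := congrArg f' hab
      rw [hk', hk'] at this
      simpa using this
    · intro m
      refine ⟨f' (k⁻¹ * m * k), ?_⟩
      rw [hk]
      group
  refine ⟨MHat.equivOfBijective f hbij, fun v => ?_, hfc⟩
  obtain ⟨m, hm⟩ := toAHat_surjective (e v).toMul
  rw [← hm]
  exact (hf v m (congrArg Additive.ofMul hm.symm)).symm

/-! ### Braid-like outer automorphisms -/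

theorem isExp_iff {r : CompletedGroupAlgebra AHat} {y : MHat} :
    IsExp basicCommutator r y ↔ expC r = y := by
  constructor
  · rintro ⟨ω, hω, rfl⟩
    exact eq_of_eq_gl (f₁ := expC) (f₂ := fun r => ω (Multiplicative.ofAdd r)) expC_add
      (fun x y => by rw [ofAdd_add, map_mul]) continuous_expC ω.continuous
      (fun g => (expC_gl g).trans (hω g).symm) r
  · rintro rfl
    exact ⟨exists_expHom.choose, exists_expHom.choose_spec, rfl⟩

theorem mk_innerAut_mul (k : MHat) (g : MHat ≃ₜ* MHat) :
    ((innerAut MHat k * g : MHat ≃ₜ* MHat) : Out MHat) = (g : Out MHat) := by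
  have h : ((innerAut MHat k : MHat ≃ₜ* MHat) : Out MHat) = 1 :=
    (QuotientGroup.eq_one_iff (innerAut MHat k)).2 (show _ ∈ (innerAut MHat).range from ⟨k, rfl⟩)
  rw [QuotientGroup.mk_mul, h, one_mul]

/-- A braid-like class has a representative whose determinant is exactly a scalar. -/
theorem isBraidLike_iff {e : (Fin 2 → ZHat) ≃ₜ+ Additive AHat} {γ : Out MHat} :
    IsBraidLike γ ↔ ∃ (g : MHat ≃ₜ* MHat) (A : GL (Fin 2) ZHat), (g : Out MHat) = γ ∧
      HasMatrix e (abAut MHat g) A ∧ g basicCommutator = expC (scalarHom AHat A.val.det) := by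
  constructor
  · rintro ⟨g, α, u, rfl, hα, hu, hαu⟩
    obtain ⟨A, hA⟩ := exists_hasMatrix e (abAut MHat g)
    obtain rfl := HasDet.eq hu hA
    obtain ⟨q, hq⟩ := QuotientGroup.eq.1 hαu
    obtain ⟨k, rfl⟩ := toAHat_surjective q
    refine ⟨innerAut MHat k * g, A, mk_innerAut_mul k g, ?_, ?_⟩
    · have h : abAut MHat (innerAut MHat k * g) = abAut MHat g :=
        congrArg (outAb MHat) (mk_innerAut_mul k g)
      rwa [h]
    · change k * g basicCommutator * k⁻¹ = _
      rw [← isExp_iff.1 hα, conj_expC]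
      congr 1
      rw [gl, hq, ← Units.val_mul, mul_comm, mul_inv_cancel_left]
      rfl
  · rintro ⟨g, A, rfl, hA, hg⟩
    refine ⟨g, Units.map (scalarHom AHat : ZHat →* CompletedGroupAlgebra AHat)
      (GeneralLinearGroup.det A), GeneralLinearGroup.det A, rfl, ?_, ⟨e, A, hA, rfl⟩, rfl⟩
    exact isExp_iff.2 hg.symm

theorem IsBraidLike.mul {γ δ : Out MHat} (hγ : IsBraidLike γ) (hδ : IsBraidLike δ) :
    IsBraidLike (γ * δ) := by
  obtain ⟨e, -⟩ := exists_basis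
  obtain ⟨g, A, rfl, hA, hg⟩ := (isBraidLike_iff (e := e)).1 hγ
  obtain ⟨h, B, rfl, hB, hh⟩ := (isBraidLike_iff (e := e)).1 hδ
  refine (isBraidLike_iff (e := e)).2 ⟨g * h, A * B, rfl, ?_, ?_⟩
  · rw [map_mul]
    exact hA.mul hB
  · change g (h basicCommutator) = _
    rw [hh, Units.val_mul, Matrix.det_mul, mul_comm, map_mul]
    exact map_expC_scalarHom (f := (g : MHat →ₜ* MHat)) hg _

theorem isBraidLike_one : IsBraidLike 1 := by
  obtain ⟨e, -⟩ := exists_basis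
  refine (isBraidLike_iff (e := e)).2 ⟨1, 1, rfl, ?_, ?_⟩
  · rw [map_one]
    exact HasMatrix.one
  · rw [Units.val_one, Matrix.det_one, map_one, expC_one]
    rfl

/-- A braid-like class is determined by its action on the abelianization. -/
theorem IsBraidLike.eq_one {γ : Out MHat} (hγ : IsBraidLike γ) (h : outAb MHat γ = 1) : γ = 1 := by
  obtain ⟨e, -⟩ := exists_basis
  obtain ⟨g, A, rfl, hA, hg⟩ := (isBraidLike_iff (e := e)).1 hγ
  have h' : abAut MHat g = 1 := h
  rw [h'] at hA
  obtain rfl := hA.unique HasMatrix.one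
  rw [Units.val_one, Matrix.det_one, map_one, expC_one] at hg
  obtain ⟨k, hk⟩ := exists_eq_conj (f := (g : MHat →ₜ* MHat)) (g := 1)
    (fun m => DFunLike.congr_fun h' (toAHat m)) (by
      rw [one_mul, inv_one, mul_one]
      exact hg)
  exact (QuotientGroup.eq_one_iff g).2 ⟨k, ContinuousMulEquiv.ext fun m => (hk m).symm⟩

theorem exists_isBraidLike {e : (Fin 2 → ZHat) ≃ₜ+ Additive AHat}
    (he : ∀ i, e (Pi.single i 1) = Additive.ofMul (genA i)) (A : GL (Fin 2) ZHat) :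
    ∃ γ, IsBraidLike γ ∧ HasMatrix e (outAb MHat γ) A := by
  obtain ⟨g, hA, hg⟩ := exists_aut_of_matrix he A
  exact ⟨g, (isBraidLike_iff (e := e)).2 ⟨g, A, rfl, hA, hg⟩, hA⟩

/-- The group of braid-like outer automorphisms. The inverse of a braid-like class is the
braid-like class with the inverse matrix. -/
def braidLike : Subgroup (Out MHat) where
  carrier := {γ | IsBraidLike γ}
  one_mem' := isBraidLike_one
  mul_mem' := IsBraidLike.mul
  inv_mem' := by
    intro γ hγ
    obtain ⟨e, he⟩ := exists_basis
    obtain ⟨A, hA⟩ := exists_hasMatrix e (outAb MHat γ)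
    obtain ⟨δ, hδ, hδA⟩ := exists_isBraidLike he A⁻¹
    have h : γ * δ = 1 := (IsBraidLike.mul hγ hδ).eq_one <| by
      have h1 := hA.mul hδA
      rw [mul_inv_cancel] at h1
      rw [map_mul]
      exact h1.ext HasMatrix.one
    rw [inv_eq_of_mul_eq_one_right h]
    exact hδ

theorem exists_braidLike_equiv {e : (Fin 2 → ZHat) ≃ₜ+ Additive AHat}
    (he : ∀ i, e (Pi.single i 1) = Additive.ofMul (genA i)) :
    ∃ Φ : braidLike ≃* GL (Fin 2) ZHat, ∀ γ : braidLike, HasMatrix e (outAb MHat γ) (Φ γ) := by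
  choose M hM using exists_hasMatrix e
  let φ : braidLike →* GL (Fin 2) ZHat := MonoidHom.mk' (fun γ => M (outAb MHat γ)) fun γ δ =>
    (hM _).unique (by
      rw [Subgroup.coe_mul, map_mul]
      exact (hM _).mul (hM _))
  refine ⟨MulEquiv.ofBijective φ ⟨?_, ?_⟩, fun γ => hM _⟩
  · rw [injective_iff_map_eq_one]
    intro γ hγ
    refine Subtype.ext (IsBraidLike.eq_one γ.2 ?_)
    have h1 := hM (outAb MHat γ)
    have h2 : M (outAb MHat γ) = 1 := hγ
    rw [h2] at h1
    exact h1.ext HasMatrix.one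
  · intro A
    obtain ⟨γ, hγ, hA⟩ := exists_isBraidLike he A
    exact ⟨⟨γ, hγ⟩, (hM _).unique hA⟩

/-! ### Normal subgroups and endomorphisms trivial on the abelianization -/

/-- A closed normal subgroup meets the derived subgroup in a submodule. -/
theorem expC_mul_mem {N : Subgroup MHat} [N.Normal] (hN : IsClosed (N : Set MHat))
    {t : CompletedGroupAlgebra AHat} (ht : expC t ∈ N) (r : CompletedGroupAlgebra AHat) :
    expC (r * t) ∈ N := by
  refine CompletedGroupAlgebra.mem_of_isClosed
    (H := (Subgroup.toAddSubgroup N).comap (expAdd.comp (AddMonoidHom.mulRight t))) ?_ ?_ r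
  · exact hN.preimage (continuous_expC.comp (continuous_id.mul continuous_const))
  · intro q
    obtain ⟨g, rfl⟩ := toAHat_surjective q
    change expC (gl (toAHat g) * t) ∈ N
    rw [← conj_expC]
    exact (inferInstance : N.Normal).conj_mem _ ht g

/-- An endomorphism `f` that is trivial on the abelianization preserves every closed normal
subgroup. If `f(x₁) = c ^ r x₁` and `f(x₂) = c ^ s x₂`, then `f(m) m⁻¹` is the product of the `s`-th power
of `[x₁, m]` and the `-r`-th power of `[x₂, m]`: both sides are crossed homomorphisms and they agree
on the generators. -/
theorem map_mem_of_isClosed {f : MHat →ₜ* MHat} (hf : ∀ m, toAHat (f m) = toAHat m)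
    {N : Subgroup MHat} [N.Normal] (hN : IsClosed (N : Set MHat)) {n : MHat} (hn : n ∈ N) :
    f n ∈ N := by
  obtain ⟨r, hr⟩ := exists_eq_expC_mul (hf (gen 0))
  obtain ⟨s, hs⟩ := exists_eq_expC_mul (hf (gen 1))
  choose k hk using fun (i : Fin 2) (m : MHat) =>
    mem_derivedMHat_iff.1 (commutator_mem_derivedMHat (gen i) m)
  have hcont : ∀ i, Continuous (k i) := by
    intro i
    rw [(continuous_expC.isClosedEmbedding expC_injective).isInducing.continuous_iff]
    have : expC ∘ k i = fun m => ⁅gen i, m⁆ := funext (hk i)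
    rw [this]
    simp only [commutatorElement_def]
    fun_prop
  have hmul : ∀ i m n, k i (m * n) = k i m + gl (toAHat m) * k i n := by
    intro i m n
    refine expC_injective ?_
    rw [expC_add, ← conj_expC, hk, hk, hk]
    simp only [commutatorElement_def]
    group
  have hself : ∀ i, k i (gen i) = 0 := fun i => expC_injective <| by
    rw [hk, commutatorElement_self, expC_zero]
  have h01 : k 0 (gen 1) = 1 := expC_injective <| by
    rw [hk, expC_one]
    rfl
  have h10 : k 1 (gen 0) = -1 := expC_injective <| by
    rw [hk, expC_neg, expC_one, basicCommutator, commutatorElement_inv]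
  let D : MHat → CompletedGroupAlgebra AHat := fun m => s * k 0 m - r * k 1 m
  have hD : ∀ m n, D (m * n) = D m + gl (toAHat m) * D n := by
    intro m n
    simp only [D, hmul]
    ring
  have hDc : Continuous D :=
    (continuous_const.mul (hcont 0)).sub (continuous_const.mul (hcont 1))
  let F : MHat →ₜ* MHat := ⟨MonoidHom.mk' (fun m => expC (D m) * m) fun m n => by
    rw [hD, expC_add, ← conj_expC]
    group, (continuous_expC.comp hDc).mul continuous_id⟩
  have hF : f = F := MHat.hom_ext fun i => by
    fin_cases i
    · change f (gen 0) = expC (s * k 0 (gen 0) - r * k 1 (gen 0)) * gen 0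
      rw [hr, hself, h10, mul_zero, zero_sub, mul_neg, mul_one, neg_neg]
    · change f (gen 1) = expC (s * k 0 (gen 1) - r * k 1 (gen 1)) * gen 1
      rw [hs, hself, h01, mul_zero, sub_zero, mul_one]
  have hkN : ∀ i, expC (k i n) ∈ N := by
    intro i
    rw [hk, commutatorElement_def]
    exact mul_mem ((inferInstance : N.Normal).conj_mem _ hn _) (inv_mem hn)
  rw [hF]
  change expC (s * k 0 n - r * k 1 n) * n ∈ N
  rw [sub_eq_add_neg, expC_add, expC_neg]
  exact mul_mem (mul_mem (expC_mul_mem hN (hkN 0) s) (inv_mem (expC_mul_mem hN (hkN 1) r))) hn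

/-! ### Gaschütz' lemma -/

/-- The number of lifts of a generating tuple of the quotient that generate a given subgroup `C`
mapping onto the quotient does not depend on the tuple. All lifts with entries in `C` are counted
first; they generate subgroups of `C`. -/
theorem card_generating_lifts_eq {E H ι : Type*} [Group E] [Finite E] [Group H] [Finite ι]
    {π : E →* H} {g g' : ι → H} (hg : Subgroup.closure (Set.range g) = ⊤)
    (hg' : Subgroup.closure (Set.range g') = ⊤) (C : Subgroup E) (hC : C.map π = ⊤) :
    Nat.card {e : ι → E // Subgroup.closure (Set.range e) = C ∧ ∀ i, π (e i) = g i} =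
      Nat.card {e : ι → E // Subgroup.closure (Set.range e) = C ∧ ∀ i, π (e i) = g' i} := by
  classical
  have : Fintype (ι → E) := Fintype.ofFinite _
  have : Fintype (Subgroup E) := Fintype.ofFinite _
  let lifts (C : Subgroup E) (g : ι → H) : Finset (ι → E) :=
    {e | ∀ i, e i ∈ C ∧ π (e i) = g i}
  have hsum : ∀ (C : Subgroup E) (g : ι → H), (lifts C g).card =
      ∑ C' : Subgroup E with C' ≤ C,
        Nat.card {e : ι → E // Subgroup.closure (Set.range e) = C' ∧ ∀ i, π (e i) = g i} := by
    intro C g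
    rw [Finset.card_eq_sum_card_fiberwise (f := fun e : ι → E => Subgroup.closure (Set.range e))
      (t := ({C' | C' ≤ C} : Finset (Subgroup E)))]
    · refine Finset.sum_congr rfl fun C' hC' => ?_
      rw [Nat.card_eq_fintype_card, Fintype.card_subtype]
      congr 1
      ext e
      simp only [lifts, Finset.mem_filter, Finset.mem_univ, true_and] at hC' ⊢
      constructor
      · rintro ⟨h1, h2⟩
        exact ⟨h2, fun i => (h1 i).2⟩
      · rintro ⟨rfl, h2⟩
        exact ⟨fun i => ⟨hC' (Subgroup.subset_closure ⟨i, rfl⟩), h2 i⟩, rfl⟩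
    · intro e he
      simp only [lifts, Finset.coe_filter, Finset.mem_univ, true_and] at he ⊢
      exact (Subgroup.closure_le _).2 (by rintro _ ⟨i, rfl⟩; exact (he i).1)
  induction C using WellFoundedLT.induction with
  | ind C ih =>
    have hcard : (lifts C g).card = (lifts C g').card := by
      have hlift : ∀ h : H, ∃ a ∈ C, π a = h := fun h => (hC ▸ Subgroup.mem_top h : h ∈ C.map π)
      choose a haC ha using hlift
      -- Translation by a lift of `g' / g` with entries in `C` is a bijection.
      refine Finset.card_bij' (fun e _ i => a (g' i) * (a (g i))⁻¹ * e i)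
        (fun e _ i => a (g i) * (a (g' i))⁻¹ * e i) ?_ ?_ ?_ ?_
      · intro e he
        simp only [lifts, Finset.mem_filter, Finset.mem_univ, true_and] at he ⊢
        intro i
        refine ⟨mul_mem (mul_mem (haC _) (inv_mem (haC _))) (he i).1, ?_⟩
        rw [map_mul, map_mul, map_inv, ha, ha, (he i).2, inv_mul_cancel_right]
      · intro e he
        simp only [lifts, Finset.mem_filter, Finset.mem_univ, true_and] at he ⊢
        intro i
        refine ⟨mul_mem (mul_mem (haC _) (inv_mem (haC _))) (he i).1, ?_⟩
        rw [map_mul, map_mul, map_inv, ha, ha, (he i).2, inv_mul_cancel_right]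
      · intro e _
        funext i
        group
      · intro e _
        funext i
        group
    rw [hsum, hsum] at hcard
    have hmem : C ∈ ({C' | C' ≤ C} : Finset (Subgroup E)) := by simp
    rw [← Finset.add_sum_erase _ _ hmem, ← Finset.add_sum_erase _ _ hmem] at hcard
    refine Nat.add_right_cancel (hcard.trans (congrArg _ (Finset.sum_congr rfl fun C' hC' => ?_)))
    simp only [Finset.mem_erase, Finset.mem_filter, Finset.mem_univ, true_and] at hC'
    by_cases h : C'.map π = ⊤
    · exact (ih C' (lt_of_le_of_ne hC'.2 hC'.1) h).symm
    · have hempty : ∀ {g : ι → H}, Subgroup.closure (Set.range g) = ⊤ →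
          IsEmpty {e : ι → E // Subgroup.closure (Set.range e) = C' ∧ ∀ i, π (e i) = g i} := by
        intro g hg
        refine ⟨fun ⟨e, he, heg⟩ => h ?_⟩
        rw [← he, MonoidHom.map_closure, ← Set.range_comp, ← hg]
        exact congrArg _ (congrArg _ (funext heg))
      have := hempty hg
      have := hempty hg'
      rw [Nat.card_of_isEmpty, Nat.card_of_isEmpty]

/-- Gaschütz' lemma: generating tuples lift along epimorphisms of finite groups to generating
tuples, provided some generating tuple of that length exists. -/
theorem exists_generating_lift {E H ι : Type*} [Group E] [Finite E] [Group H] [Finite ι]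
    {π : E →* H} (hπ : Function.Surjective π) {g : ι → H}
    (hg : Subgroup.closure (Set.range g) = ⊤)
    (hE : ∃ e : ι → E, Subgroup.closure (Set.range e) = ⊤) :
    ∃ e : ι → E, Subgroup.closure (Set.range e) = ⊤ ∧ ∀ i, π (e i) = g i := by
  obtain ⟨e, he⟩ := hE
  have hmap : (⊤ : Subgroup E).map π = ⊤ := Subgroup.map_top_of_surjective π hπ
  have hg' : Subgroup.closure (Set.range (π ∘ e)) = ⊤ := by
    rw [Set.range_comp, ← MonoidHom.map_closure, he, hmap]
  have h := card_generating_lifts_eq hg' hg ⊤ hmap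
  have hne : Nonempty {e' : ι → E //
      Subgroup.closure (Set.range e') = ⊤ ∧ ∀ i, π (e' i) = (π ∘ e) i} := ⟨⟨e, he, fun _ => rfl⟩⟩
  have hpos := Nat.card_pos (α := {e' : ι → E //
      Subgroup.closure (Set.range e') = ⊤ ∧ ∀ i, π (e' i) = (π ∘ e) i})
  rw [h] at hpos
  obtain ⟨⟨e', h1, h2⟩⟩ := (Nat.card_pos_iff.1 hpos).1
  exact ⟨e', h1, h2⟩

theorem closure_gen_sup_eq_top (N : Subgroup MHat) (hN : IsOpen (N : Set MHat)) :
    Subgroup.closure (Set.range gen) ⊔ N = ⊤ :=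
  MHat.eq_top_of_isClosed
    (Subgroup.isClosed_of_isOpen _ (Subgroup.isOpen_mono le_sup_right hN))
    fun i => Subgroup.mem_sup_left (Subgroup.subset_closure ⟨i, rfl⟩)

theorem closure_range_mk_eq_top_iff {N : Subgroup MHat} [N.Normal] {y : Fin 2 → MHat} :
    Subgroup.closure (Set.range fun i => (y i : MHat ⧸ N)) = ⊤ ↔
      Subgroup.closure (Set.range y) ⊔ N = ⊤ := by
  have h : Subgroup.closure (Set.range fun i => (y i : MHat ⧸ N)) =
      (Subgroup.closure (Set.range y)).map (QuotientGroup.mk' N) := by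
    rw [MonoidHom.map_closure, ← Set.range_comp]
    rfl
  rw [h]
  constructor
  · intro h1
    have h2 := congrArg (Subgroup.comap (QuotientGroup.mk' N)) h1
    rwa [Subgroup.comap_map_eq, QuotientGroup.ker_mk', Subgroup.comap_top] at h2
  · intro h1
    have h2 := congrArg (Subgroup.map (QuotientGroup.mk' N)) h1
    rwa [Subgroup.map_sup, QuotientGroup.map_mk'_self, sup_bot_eq,
      Subgroup.map_top_of_surjective _ (QuotientGroup.mk'_surjective N)] at h2

/-- Gaschütz' lemma for the finite quotient of `MHat` by `N ⊓ ker ψ`. -/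
theorem exists_lift_closure_sup_eq_top {G : Type*} [Group G] [TopologicalSpace G]
    [DiscreteTopology G] {φ ψ : MHat →ₜ* G} (hφ : Function.Surjective φ)
    (hψ : Function.Surjective ψ) (N : OpenNormalSubgroup MHat) :
    ∃ y : Fin 2 → MHat, (∀ i, ψ (y i) = φ (gen i)) ∧
      Subgroup.closure (Set.range y) ⊔ N.toSubgroup = ⊤ := by
  let K : Subgroup MHat := N.toSubgroup ⊓ (ψ : MHat →* G).ker
  have hK : IsOpen (K : Set MHat) :=
    N.isOpen'.inter ((isOpen_discrete {1}).preimage ψ.continuous)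
  have : Finite (MHat ⧸ K) := Subgroup.quotient_finite_of_isOpen _ hK
  let π : MHat ⧸ K →* G := QuotientGroup.lift K (ψ : MHat →* G) fun x hx => hx.2
  have hπ : Function.Surjective π := fun x => by
    obtain ⟨m, rfl⟩ := hψ x
    exact ⟨m, rfl⟩
  have hgen : Subgroup.closure (Set.range fun i => φ (gen i)) = ⊤ := by
    have h1 := congrArg (Subgroup.map (φ : MHat →* G)) (closure_gen_sup_eq_top
      (φ : MHat →* G).ker ((isOpen_discrete {1}).preimage φ.continuous))
    have h2 : Subgroup.map (φ : MHat →* G) (φ : MHat →* G).ker = ⊥ :=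
      (Subgroup.map_eq_bot_iff _).2 le_rfl
    rw [Subgroup.map_sup, h2, sup_bot_eq, MonoidHom.map_closure, ← Set.range_comp] at h1
    exact h1.trans (Subgroup.map_top_of_surjective _ hφ)
  obtain ⟨z, hz, hzφ⟩ := exists_generating_lift hπ hgen
    ⟨fun i => (gen i : MHat ⧸ K), closure_range_mk_eq_top_iff.2 (closure_gen_sup_eq_top K hK)⟩
  choose y hy using fun i => QuotientGroup.mk_surjective (z i)
  obtain rfl : (fun i => (y i : MHat ⧸ K)) = z := funext hy
  refine ⟨y, hzφ, ?_⟩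
  rw [eq_top_iff, ← closure_range_mk_eq_top_iff.1 hz]
  exact sup_le_sup_left inf_le_left _

theorem isClosed_closure_sup_eq_top (N : OpenNormalSubgroup MHat) :
    IsClosed {y : Fin 2 → MHat | Subgroup.closure (Set.range y) ⊔ N.toSubgroup = ⊤} := by
  have hd : DiscreteTopology (MHat ⧸ N.toSubgroup) := QuotientGroup.discreteTopology N.isOpen'
  have h : {y : Fin 2 → MHat | Subgroup.closure (Set.range y) ⊔ N.toSubgroup = ⊤} =
      (fun y i => (y i : MHat ⧸ N.toSubgroup)) ⁻¹' {z | Subgroup.closure (Set.range z) = ⊤} := by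
    ext y
    exact closure_range_mk_eq_top_iff.symm
  rw [h]
  exact (isClosed_discrete _).preimage
    (continuous_pi fun i => QuotientGroup.continuous_mk.comp (continuous_apply i))

/-- A tuple that generates every finite quotient generates `MHat` topologically. -/
theorem MHat.eq_top_of_forall_closure_sup {y : Fin 2 → MHat}
    (hy : ∀ N : OpenNormalSubgroup MHat, Subgroup.closure (Set.range y) ⊔ N.toSubgroup = ⊤)
    {H : Subgroup MHat} (hH : IsClosed (H : Set MHat)) (hyH : ∀ i, y i ∈ H) : H = ⊤ := by
  rw [eq_top_iff]
  intro m _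
  by_contra hm
  obtain ⟨N, hN⟩ := ProfiniteGrp.exist_openNormalSubgroup_sub_open_nhds_of_one
    (G := MHat) (U := (fun x => m * x) ⁻¹' (H : Set MHat)ᶜ)
    (hH.isOpen_compl.preimage (continuous_const.mul continuous_id)) (by simpa using hm)
  have hm' : m ∈ Subgroup.closure (Set.range y) ⊔ N.toSubgroup := by
    rw [hy N]
    exact Subgroup.mem_top m
  obtain ⟨a, ha, b, hb, hab⟩ := Subgroup.mem_sup_of_normal_right.1 hm'
  have hle : Subgroup.closure (Set.range y) ≤ H :=
    (Subgroup.closure_le H).2 (Set.range_subset_iff.2 hyH)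
  have hb' : b⁻¹ ∈ N.toSubgroup := inv_mem hb
  have hN' : m * b⁻¹ ∉ H := hN hb'
  rw [← hab, mul_inv_cancel_right] at hN'
  exact hN' (hle ha)

/-- The profinite form of Gaschütz' lemma for `MHat`, obtained from the finite one by
compactness. -/
theorem exists_topologically_generating_lift {G : Type*} [Group G] [TopologicalSpace G]
    [DiscreteTopology G] {φ ψ : MHat →ₜ* G} (hφ : Function.Surjective φ)
    (hψ : Function.Surjective ψ) :
    ∃ y : Fin 2 → MHat, (∀ i, ψ (y i) = φ (gen i)) ∧
      ∀ H : Subgroup MHat, IsClosed (H : Set MHat) → (∀ i, y i ∈ H) → H = ⊤ := by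
  let T : Set (Fin 2 → MHat) := {y | ∀ i, ψ (y i) = φ (gen i)}
  let S : OpenNormalSubgroup MHat → Set (Fin 2 → MHat) := fun N =>
    T ∩ {y | Subgroup.closure (Set.range y) ⊔ N.toSubgroup = ⊤}
  have hT : IsClosed T := by
    have h : T = ⋂ i, (fun y : Fin 2 → MHat => ψ (y i)) ⁻¹' {φ (gen i)} := by
      ext y
      simp [T]
    rw [h]
    exact isClosed_iInter fun i =>
      (isClosed_discrete _).preimage (ψ.continuous.comp (continuous_apply i))
  have hmono : ∀ N N' : OpenNormalSubgroup MHat, N.toSubgroup ≤ N'.toSubgroup → S N ⊆ S N' := by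
    intro N N' h y hy
    refine ⟨hy.1, ?_⟩
    have h2 : Subgroup.closure (Set.range y) ⊔ N.toSubgroup = ⊤ := hy.2
    change Subgroup.closure (Set.range y) ⊔ N'.toSubgroup = ⊤
    rw [eq_top_iff, ← h2]
    exact sup_le_sup_left h _
  have hclosed : ∀ N, IsClosed (S N) := fun N => hT.inter (isClosed_closure_sup_eq_top N)
  let N₀ : OpenNormalSubgroup MHat :=
    { toOpenSubgroup := ⊤, isNormal' := (inferInstance : (⊤ : Subgroup MHat).Normal) }
  have : Nonempty (OpenNormalSubgroup MHat) := ⟨N₀⟩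
  obtain ⟨y, hy⟩ := IsCompact.nonempty_iInter_of_directed_nonempty_isCompact_isClosed S
    (fun N N' => ⟨N ⊓ N', hmono (N ⊓ N') N inf_le_left, hmono (N ⊓ N') N' inf_le_right⟩)
    (exists_lift_closure_sup_eq_top hφ hψ) (fun N => (hclosed N).isCompact) hclosed
  rw [Set.mem_iInter] at hy
  exact ⟨y, (hy N₀).1, fun H => MHat.eq_top_of_forall_closure_sup fun N => (hy N).2⟩

/-! ### Orbits of exterior epimorphisms -/

/-- Two epimorphisms from `MHat` onto a finite group differ by a braid-like automorphism of `MHat`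
and an automorphism of the target. A topologically generating lift gives an endomorphism connecting
them; it differs from the braid-like automorphism with the same matrix by an endomorphism that is trivial
on the abelianization, which preserves the kernel and so descends to the target. -/
theorem exists_eq_comp_comp {G : Type*} [Group G] [Finite G] [TopologicalSpace G]
    [DiscreteTopology G] {φ ψ : MHat →ₜ* G} (hφ : Function.Surjective φ)
    (hψ : Function.Surjective ψ) :
    ∃ (σ : G ≃ₜ* G) (g : MHat ≃ₜ* MHat), IsBraidLike (g : Out MHat) ∧
      ∀ m, φ m = σ (ψ (g m)) := by
  obtain ⟨e, he⟩ := exists_basis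
  obtain ⟨y, hy, hgen⟩ := exists_topologically_generating_lift hφ hψ
  let A : Matrix (Fin 2) (Fin 2) ZHat :=
    Matrix.of fun i j => e.symm (Additive.ofMul (toAHat (y j))) i
  have hA : ∀ i, e (A *ᵥ Pi.single i 1) = Additive.ofMul (toAHat (y i)) := by
    intro i
    have : A *ᵥ Pi.single i 1 = e.symm (Additive.ofMul (toAHat (y i))) := by
      rw [Matrix.mulVec_single_one]
      rfl
    rw [this, e.apply_symm_apply]
  have hsurj : Function.Surjective A.mulVec := by
    let κ : (Fin 2 → ZHat) →+ Additive AHat :=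
      (e : (Fin 2 → ZHat) →+ Additive AHat).comp A.mulVecLin.toAddMonoidHom
    have hκ : Continuous κ := e.continuous.comp (continuous_const.matrix_mulVec continuous_id)
    have : T2Space (Additive AHat) := (inferInstance : T2Space AHat)
    have hc : IsClosed (κ.range : Set (Additive AHat)) := (isCompact_range hκ).isClosed
    let H : Subgroup MHat := (AddSubgroup.toSubgroup' κ.range).comap (toAHat : MHat →* AHat)
    have hH : H = ⊤ := hgen H (hc.preimage toAHat.continuous) fun i => ⟨_, hA i⟩
    intro v
    obtain ⟨m, hm⟩ := toAHat_surjective (e v).toMul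
    obtain ⟨w, hw⟩ := (hH ▸ Subgroup.mem_top m : m ∈ H)
    refine ⟨w, e.injective ?_⟩
    exact hw.trans (congrArg Additive.ofMul hm)
  obtain ⟨A', hA'⟩ := Matrix.mulVec_surjective_iff_exists_right_inverse.1 hsurj
  obtain ⟨g, hg, hgc⟩ := exists_aut_of_matrix he ⟨A, A', hA', mul_eq_one_comm.1 hA'⟩
  obtain ⟨f, hf⟩ := MHat.exists_endo y
  have hfg : toAHat.comp f = toAHat.comp (g : MHat →ₜ* MHat) := MHat.hom_ext fun i => by
    change toAHat (f (gen i)) = toAHat (g (gen i))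
    rw [hf]
    have h1 := hg (Pi.single i 1)
    rw [hA, he] at h1
    exact (congrArg Additive.toMul h1).symm
  let ι : MHat →ₜ* MHat := f.comp (g.symm : MHat →ₜ* MHat)
  have hι : ∀ m, toAHat (ι m) = toAHat m := by
    intro m
    have h1 : toAHat (f (g.symm m)) = toAHat (g (g.symm m)) := DFunLike.congr_fun hfg (g.symm m)
    rwa [g.apply_symm_apply] at h1
  have hψf : ψ.comp f = φ := MHat.hom_ext fun i => by
    change ψ (f (gen i)) = φ (gen i)
    rw [hf, hy]
  have hker : (ψ : MHat →* G).ker ≤ ((ψ.comp ι : MHat →ₜ* G) : MHat →* G).ker := by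
    intro n hn
    exact map_mem_of_isClosed hι (N := (ψ : MHat →* G).ker)
      ((isClosed_discrete {1}).preimage ψ.continuous) hn
  let σ : G →* G := MonoidHom.liftOfSurjective (ψ : MHat →* G) hψ
    ⟨((ψ.comp ι : MHat →ₜ* G) : MHat →* G), hker⟩
  have hσ : ∀ m, σ (ψ m) = ψ (ι m) := fun m =>
    MonoidHom.liftOfRightInverse_comp_apply _ _ _ _ m
  have hφσ : ∀ m, φ m = σ (ψ (g m)) := by
    intro m
    rw [hσ, ← hψf]
    change ψ (f m) = ψ (f (g.symm (g m)))
    rw [g.symm_apply_apply]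
  have hσs : Function.Surjective σ := fun x => by
    obtain ⟨m, rfl⟩ := hφ x
    exact ⟨_, (hφσ m).symm⟩
  refine ⟨{ MulEquiv.ofBijective σ ⟨Finite.injective_iff_surjective.2 hσs, hσs⟩ with
    continuous_toFun := continuous_of_discreteTopology
    continuous_invFun := continuous_of_discreteTopology }, g, ?_, hφσ⟩
  exact (isBraidLike_iff (e := e)).2 ⟨g, _, rfl, hg, hgc⟩

theorem smul_smul_comm_epiExt {G : Type*} [Group G] [TopologicalSpace G] [IsTopologicalGroup G]
    (σ : Out G) (b : (Out MHat)ᵐᵒᵖ) (φ : EpiExt MHat G) : σ • b • φ = b • σ • φ := by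
  obtain ⟨σ⟩ := σ
  obtain ⟨⟨b⟩⟩ := b
  obtain ⟨φ⟩ := φ
  rfl

theorem exists_smul_smul_eq {G : Type*} [Group G] [Finite G] [TopologicalSpace G]
    [DiscreteTopology G] (φ ψ : EpiExt MHat G) :
    ∃ (σ : Out G) (b : braidLike.op), φ = σ • b • ψ := by
  obtain ⟨φ⟩ := φ
  obtain ⟨ψ⟩ := ψ
  obtain ⟨σ, g, hg, h⟩ := exists_eq_comp_comp φ.2 ψ.2
  refine ⟨σ, ⟨MulOpposite.op (g : Out MHat), hg⟩, ?_⟩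
  refine congrArg (Quotient.mk _) (Subtype.ext ?_)
  exact ContinuousMonoidHom.ext h

theorem image_orbit {G : Type*} [Group G] [TopologicalSpace G] [IsTopologicalGroup G]
    (σ : Out G) (φ : EpiExt MHat G) :
    (fun ψ => σ • ψ) '' MulAction.orbit braidLike.op φ =
      MulAction.orbit braidLike.op (σ • φ) := by
  ext ψ
  constructor
  · rintro ⟨_, ⟨b, rfl⟩, rfl⟩
    exact ⟨b, (smul_smul_comm_epiExt σ b.1 φ).symm⟩
  · rintro ⟨b, rfl⟩
    exact ⟨b • φ, ⟨b, rfl⟩, smul_smul_comm_epiExt σ b.1 φ⟩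

theorem exists_image_orbit_eq {G : Type*} [Group G] [Finite G] [TopologicalSpace G]
    [DiscreteTopology G] (φ ψ : EpiExt MHat G) :
    ∃ σ : Out G, (fun θ => σ • θ) '' MulAction.orbit braidLike.op φ =
      MulAction.orbit braidLike.op ψ := by
  obtain ⟨σ, b, h⟩ := exists_smul_smul_eq ψ φ
  refine ⟨σ, ?_⟩
  have h' : ψ = b • σ • φ := h.trans (smul_smul_comm_epiExt σ b.1 φ)
  rw [image_orbit, h', MulAction.orbit_smul]

theorem nonempty_epiExt {G : Type*} [Group G] [Finite G] [TopologicalSpace G]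
    (h2 : ∃ x y : G, Subgroup.closure {x, y} = ⊤) (hG : derivedSeries G 2 = ⊥) :
    Nonempty (EpiExt MHat G) := by
  obtain ⟨x, y, hxy⟩ := h2
  obtain ⟨φ, hφ⟩ := MHat.exists_lift hG ![x, y]
  refine ⟨Quotient.mk _ ⟨φ, ?_⟩⟩
  have h : (φ : MHat →* G).range = ⊤ := by
    rw [eq_top_iff, ← hxy, Subgroup.closure_le]
    rintro _ (rfl | rfl)
    · exact ⟨gen 0, hφ 0⟩
    · exact ⟨gen 1, hφ 1⟩
  exact MonoidHom.range_eq_top.1 h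

end

theorem mainTheorem11 :
    ∃ B : Subgroup (Out MHat),
      -- `B` is the set of braid-like outer automorphisms
      (B : Set (Out MHat)) = {γ | IsBraidLike γ} ∧
      -- abelianization identifies it with `GL₂(Ẑ)`
      (∃ (e : (Fin 2 → ZHat) ≃ₜ+ Additive AHat) (Φ : B ≃* GL (Fin 2) ZHat),
        (∀ i : Fin 2, e (Pi.single i 1) = Additive.ofMul (QuotientGroup.mk (gen i) : AHat)) ∧
        ∀ γ : B, HasMatrix e (outAb MHat γ) (Φ γ)) ∧
      ∀ (G : Type*) [Group G] [Finite G] [TopologicalSpace G] [DiscreteTopology G],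
        (∃ x y : G, Subgroup.closure {x, y} = ⊤) → derivedSeries G 2 = ⊥ →
        Nonempty (EpiExt MHat G) ∧
        -- `Out(G)` permutes the `B`-orbits
        (∀ (σ : Out G) (φ : EpiExt MHat G),
          (fun ψ => σ • ψ) '' MulAction.orbit B.op φ = MulAction.orbit B.op (σ • φ)) ∧
        -- transitively
        (∀ φ ψ : EpiExt MHat G, ∃ σ : Out G,
          (fun θ => σ • θ) '' MulAction.orbit B.op φ = MulAction.orbit B.op ψ) ∧
        -- any two `B`-orbits are isomorphic as sets with `B`-action
        (∀ φ ψ : EpiExt MHat G, ∃ f : MulAction.orbit B.op φ ≃ MulAction.orbit B.op ψ,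
          ∀ (b : B.op) (x : MulAction.orbit B.op φ), f (b • x) = b • f x) := by
  obtain ⟨e, he⟩ := exists_basis
  obtain ⟨Φ, hΦ⟩ := exists_braidLike_equiv he
  refine ⟨braidLike, rfl, ⟨e, Φ, he, hΦ⟩, ?_⟩
  intro G _ _ _ _ h2 hG
  refine ⟨nonempty_epiExt h2 hG, image_orbit, exists_image_orbit_eq, fun φ ψ => ?_⟩
  obtain ⟨σ, hσ⟩ := exists_image_orbit_eq φ ψ
  refine ⟨((MulAction.toPerm σ).image _).trans (Equiv.setCongr hσ), fun b x => ?_⟩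
  exact Subtype.ext (smul_smul_comm_epiExt σ b.1 x.1)
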